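/- **Setting.** Minkowski space is $\mathbb M=\mathbb R^4$ with metric $g=\mathrm{diag}(1,-1,-1,-1)$. A configuration is a pair $(h,a)\in C^\infty(\mathbb M,\mathbb C)\times C^\infty(\mathbb M,\mathbb R^4)$, and the basic fields are the evaluation functionals $\phi(x)[h,a]=h(x)$, $\phi^*(x)[h,a]=\overline{h(x)}$, $A^\mu(x)[h,a]=a^\mu(x)$. Let $\mathcal P$ be the space of complex polynomials in $A^\mu,\phi,\phi^*,\partial^\mu\phi,\partial^\mu\phi^*$, let $m\in\mathbb R$, and let the subscript $0$ denote restriction of functionals to the configurations with $(\square+m^2)h=0$ and $\square a^\mu=0$. For $B,B_1,B_2\in\mathcal P$ put $$\theta B=\phi\tfrac{\partial B}{\partial\phi}+\partial^\mu\phi\tfrac{\partial B}{\partial(\partial^\mu\phi)}-\phi^*\tfrac{\partial B}{\partial\phi^*}-\partial^\mu\phi^*\tfrac{\partial B}{\partial(\partial^\mu\phi^*)},\qquad \theta_\mu B=\phi\tfrac{\partial B}{\partial(\partial^\mu\phi)}-\phi^*\tfrac{\partial B}{\partial(\partial^\mu\phi^*)},$$ $$\zeta(B_1,B_2)=\tfrac{\partial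 B_1}{\partial(\partial^\mu\phi^*)}\tfrac{\partial B_2}{\partial(\partial_\mu\phi)}+\tfrac{\partial B_1}{\partial(\partial^\mu\phi)}\tfrac{\partial B_2}{\partial(\partial_\mu\phi^*)},\qquad j^\mu=i(\phi\,\partial^\mu\phi^*-\phi^*\partial^\mu\phi).$$ Let $T=(T_n)_{n\ge1}$ be a time-ordered product. Only the following of its properties are used: each $T_n$ maps $(B_1,\dots,B_n)\in\mathcal P^n$ to a distribution $T_n(B_1(x_1)\otimes\cdots\otimes B_n(x_n))$ on $\mathbb M^n$ with values in functionals on the configurations (with pointwise convergence), is multilinear, is symmetric under simultaneous permutations of the $B_l$ and $x_l$, and satisfies $T_1(B(x))=B(x)$; the statement holds for every such sequence, whether or not it also satisfies causality or further renormalization conditions. For $c\in\mathbb R$ let $Z_c^{(1)}(B(x))=B(x)$, $Z_c^{(2)}(B_1(x_1),B_2(x_2))=c\,\zeta(B_1,B_2)(x_1)\,\delta(x_1-x_2)$, $Z_c^{(k)}=0$ for $k\ge3$, and define $\hat T_c=(\hat T_{c,n})_{n\ge 1}$ by $$i^n\,\hat T_{c,n}\Bigl(\bigotimes_{j=1}^nB_j(x_j)\Bigr)=\sum_{P}i^{|P|}\,T_{|P|}\Bigl(\bigotimes_{I\in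 P}Z_c^{(|I|)}\bigl(\textstyle\bigotimes_{j\in I}B_j(x_j)\bigr)\Bigr),$$ the sum running over all partitions $P$ of $\{1,\dots,n\}$ into blocks with one or two elements. Call $B\in\mathcal P$ admissible if $\theta B=bB$ for some $b\in\mathbb Z$ and if $B$ contains at most one derivated basic field, i.e. $\frac{\partial^2B}{\partial(\partial^\mu\phi)\partial(\partial^\nu\phi)}=\frac{\partial^2B}{\partial(\partial^\mu\phi^*)\partial(\partial^\nu\phi)}=\frac{\partial^2B}{\partial(\partial^\mu\phi^*)\partial(\partial^\nu\phi^*)}=0$ for all $\mu,\nu$. **Theorem.** The sequence $\hat T_c$ is again multilinear and symmetric and satisfies $\hat T_{c,1}(B(x))=B(x)$. The following are equivalent: (MWI) for all $n\ge1$ and all admissible $B_1,\dots,B_n$, $$\partial_y^\mu T_{n+1}\bigl(B_1(x_1)\otimes\cdots\otimes B_n(x_n)\otimes j_\mu(y)\bigr)_0=\sum_{l=1}^n\delta(y-x_l)\,T_n\bigl(B_1(x_1)\otimes\cdots\otimes(\theta B_l)(x_l)\otimes\cdots\otimes B_n(x_n)\bigr)_0$$ $$\qquad-\partial^\mu_y\Bigl(\sum_{l=1}^n\delta(y-x_l)\,T_n\bigl(B_1(x_1)\otimes\cdots\otimes(\theta_\mu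 B_l)(x_l)\otimes\cdots\otimes B_n(x_n)\bigr)_0\Bigr);$$ (WI-c) for all $n\ge1$ and all admissible $B_1,\dots,B_n$, $$\partial_y^\mu \hat T_{c,n+1}\bigl(B_1(x_1)\otimes\cdots\otimes B_n(x_n)\otimes j_\mu(y)\bigr)_0=\sum_{l=1}^n\delta(y-x_l)\,\hat T_{c,n}\bigl(B_1(x_1)\otimes\cdots\otimes(\theta B_l)(x_l)\otimes\cdots\otimes B_n(x_n)\bigr)_0$$ $$\qquad+(c-1)\,\partial^\mu_y\Bigl(\sum_{l=1}^n\delta(y-x_l)\,\hat T_{c,n}\bigl(B_1(x_1)\otimes\cdots\otimes(\theta_\mu B_l)(x_l)\otimes\cdots\otimes B_n(x_n)\bigr)_0\Bigr).$$ The equivalence also holds up to any finite order: for every $N$, (MWI) for all $n\le N$ is equivalent to (WI-c) for all $n\le N$. For $c=1$, (WI-c) is the naive Ward identity for $\hat T_1$ (the identity (WI-c) without its last line). For $c=0$ one has $\hat T_0=T$, and (WI-c) is the identity (MWI). -/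

import Mathlib

open scoped Distributions ContDiff LineDeriv

noncomputable section

namespace ScalarQED

/-! ### Spacetime, configurations, field polynomials -/

/-- Points of Minkowski space, in contravariant coordinates `x^0, …, x^3`. -/
abbrev Spacetime : Type := Fin 4 → ℝ

/-- Diagonal entries of the Minkowski metric `g = diag(1,-1,-1,-1)` (which is its own inverse):
`g^{μμ} = g_{μμ} = η μ`. -/
def η (μ : Fin 4) : ℝ := if μ = 0 then 1 else -1

/-- The standard basis vector `e_μ`; differentiating along it is `∂_μ = ∂/∂x^μ`. -/
def e (μ : Fin 4) : Spacetime := Pi.single μ 1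

/-- A classical configuration `(h, a)`: `h` for the complex scalar field, `a = (a^μ)` for the
photon field. -/
structure Config where
  h : Spacetime → ℂ
  a : Spacetime → Fin 4 → ℝ
  h_smooth : ContDiff ℝ ∞ h
  a_smooth : ContDiff ℝ ∞ a

/-- `∂_μ f`. -/
def partialD {E : Type*} [NormedAddCommGroup E] [NormedSpace ℝ E]
    (μ : Fin 4) (f : Spacetime → E) : Spacetime → E :=
  fun x => fderiv ℝ f x (e μ)

/-- The wave operator `□ = ∂_μ ∂^μ`. -/
def box {E : Type*} [NormedAddCommGroup E] [NormedSpace ℝ E] (f : Spacetime → E) :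
    Spacetime → E :=
  fun x => ∑ μ : Fin 4, η μ • partialD μ (partialD μ f) x

/-- Solutions of the free field equations: Klein–Gordon for the scalar field, the wave equation
(Feynman gauge) for every component of the photon field. -/
def Config.IsOnShell (m : ℝ) (s : Config) : Prop :=
  (∀ x, box s.h x + (m : ℂ) ^ 2 * s.h x = 0) ∧
    ∀ (ν : Fin 4) (x : Spacetime), box (fun y => s.a y ν) x = 0

/-- The generators `A^μ, φ, φ^*, ∂^μφ, ∂^μφ^*` (all Lorentz indices are upper indices). -/
inductive FieldSymbol : Type
  | A (μ : Fin 4)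
  | phi
  | phiStar
  | dphi (μ : Fin 4)
  | dphiStar (μ : Fin 4)

/-- The space `𝒫` of field polynomials in `A^μ, φ, φ^*, ∂^μφ, ∂^μφ^*`. -/
abbrev FieldPoly : Type := MvPolynomial FieldSymbol ℂ

open MvPolynomial FieldSymbol

/-- The values at `x` of the basic fields on a configuration; note `∂^μ = g^{μμ} ∂_μ`. -/
def basicField (s : Config) (x : Spacetime) : FieldSymbol → ℂ
  | A μ => (s.a x μ : ℂ)
  | phi => s.h x
  | phiStar => starRingEnd ℂ (s.h x)
  | dphi μ => (η μ : ℂ) * partialD μ s.h x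
  | dphiStar μ => (η μ : ℂ) * starRingEnd ℂ (partialD μ s.h x)

/-- The evaluation `B(x)[h,a]` of a field polynomial. -/
def evalField (B : FieldPoly) (s : Config) (x : Spacetime) : ℂ :=
  MvPolynomial.eval (basicField s x) B

/-- The charge number operator `θ`. -/
def θ (B : FieldPoly) : FieldPoly :=
  X phi * pderiv phi B + ∑ μ : Fin 4, X (dphi μ) * pderiv (dphi μ) B
    - X phiStar * pderiv phiStar B - ∑ μ : Fin 4, X (dphiStar μ) * pderiv (dphiStar μ) B

/-- The operator `θ_μ` (lower index): `θ_μ B = φ ∂B/∂(∂^μφ) - φ^* ∂B/∂(∂^μφ^*)`. -/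
def θlow (μ : Fin 4) (B : FieldPoly) : FieldPoly :=
  X phi * pderiv (dphi μ) B - X phiStar * pderiv (dphiStar μ) B

/-- The current `j^μ = i (φ ∂^μφ^* - φ^* ∂^μφ)`. -/
def j (μ : Fin 4) : FieldPoly :=
  C Complex.I * (X phi * X (dphiStar μ) - X phiStar * X (dphi μ))

/-- `ζ(B₁,B₂) = ∂B₁/∂(∂^μφ^*) ∂B₂/∂(∂_μφ) + ∂B₁/∂(∂^μφ) ∂B₂/∂(∂_μφ^*)`, where
`∂/∂(∂_μφ) = g^{μμ} ∂/∂(∂^μφ)`. -/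
def ζ (B₁ B₂ : FieldPoly) : FieldPoly :=
  ∑ μ : Fin 4, C (η μ : ℂ) *
    (pderiv (dphiStar μ) B₁ * pderiv (dphi μ) B₂ + pderiv (dphi μ) B₁ * pderiv (dphiStar μ) B₂)

/-- `B` is an eigenvector of `θ` with an integer eigenvalue. -/
def IsChargeEigenvector (B : FieldPoly) : Prop := ∃ b : ℤ, θ B = C (b : ℂ) * B

/-- `B` contains at most one derivated basic field. -/
def AtMostOneDerivative (B : FieldPoly) : Prop :=
  ∀ μ ν : Fin 4,
    pderiv (dphi μ) (pderiv (dphi ν) B) = 0 ∧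
    pderiv (dphiStar μ) (pderiv (dphi ν) B) = 0 ∧
    pderiv (dphiStar μ) (pderiv (dphiStar ν) B) = 0

/-- The two assumptions on the field polynomials. -/
def Admissible (B : FieldPoly) : Prop := IsChargeEigenvector B ∧ AtMostOneDerivative B

/-! ### Functional-valued distributions on `𝕄ⁿ` -/

/-- Functionals on the configuration space, with the topology of pointwise convergence. -/
abbrev Functional : Type := Config → ℂ

/-- Real test functions on `𝕄ⁿ`. -/
abbrev TestFun (n : ℕ) : Type := 𝓓((⊤ : TopologicalSpace.Opens (Fin n → Spacetime)), ℝ)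

/-- Functional-valued distributions on `𝕄ⁿ`. -/
abbrev FieldDistribution (n : ℕ) : Type :=
  𝓓'((⊤ : TopologicalSpace.Opens (Fin n → Spacetime)), Functional)

/-- Multiplication of a functional-valued distribution by a complex number. -/
def cmul {n : ℕ} (z : ℂ) (S : FieldDistribution n) : FieldDistribution n :=
  Distribution.mapCLM (z • ContinuousLinearMap.id ℝ Functional) S

@[simp] theorem cmul_apply {n : ℕ} (z : ℂ) (S : FieldDistribution n) (g : TestFun n)
    (s : Config) : cmul z S g s = z * S g s := rfl

/-- For `σ : {1,…,n} → {1,…,k}`, the linear map `𝕄ᵏ → 𝕄ⁿ`, `(x_1,…,x_k) ↦ (x_{σ 1},…,x_{σ n})`. -/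
def reindex {n k : ℕ} (σ : Fin n → Fin k) : (Fin k → Spacetime) →L[ℝ] (Fin n → Spacetime) :=
  ContinuousLinearMap.pi fun i => ContinuousLinearMap.proj (σ i)

@[simp] theorem reindex_apply {n k : ℕ} (σ : Fin n → Fin k) (x : Fin k → Spacetime) (i : Fin n) :
    reindex σ x i = x (σ i) := rfl

theorem isClosedEmbedding_reindex {n k : ℕ} {σ : Fin n → Fin k} (hσ : Function.Surjective σ) :
    Topology.IsClosedEmbedding (reindex σ) :=
  LinearMap.isClosedEmbedding_of_injective (f := (reindex σ).toLinearMap) <|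
    LinearMap.ker_eq_bot.2 fun x y h => funext fun a => by
      obtain ⟨i, rfl⟩ := hσ a
      exact congrFun h i

/-- The compact preimage of a compact set under `reindex σ`. -/
def reindexCompacts {n k : ℕ} {σ : Fin n → Fin k} (hσ : Function.Surjective σ)
    (K : TopologicalSpace.Compacts (Fin n → Spacetime)) :
    TopologicalSpace.Compacts (Fin k → Spacetime) :=
  ⟨reindex σ ⁻¹' K, (isClosedEmbedding_reindex hσ).isCompact_preimage K.isCompact⟩

/-- Restriction along `reindex σ` of smooth functions supported in a fixed compact set. -/
def restrictSupportedIn {n k : ℕ} {σ : Fin n → Fin k} (hσ : Function.Surjective σ)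
    (K : TopologicalSpace.Compacts (Fin n → Spacetime)) :
    𝓓_{K}(Fin n → Spacetime, ℝ) →L[ℝ] 𝓓_{reindexCompacts hσ K}(Fin k → Spacetime, ℝ) :=
  letI Φ : 𝓓_{K}(Fin n → Spacetime, ℝ) →ₗ[ℝ] 𝓓_{reindexCompacts hσ K}(Fin k → Spacetime, ℝ) :=
    { toFun g := ⟨fun x => g (reindex σ x), g.contDiff.comp (reindex σ).contDiff,
        fun _ hx => g.zero_on_compl hx⟩
      map_add' _ _ := rfl
      map_smul' _ _ := rfl }
  { toLinearMap := Φ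
    cont := show Continuous Φ by
      refine WithSeminorms.continuous_of_isBounded
        (ContDiffMapSupportedIn.withSeminorms ℝ _ _ _ _)
        (ContDiffMapSupportedIn.withSeminorms ℝ _ _ _ _) _ (.of_real fun i =>
          ⟨{i}, ‖reindex σ‖ ^ i, fun g => ?_⟩)
      rw [Finset.sup_singleton]
      refine (ContDiffMapSupportedIn.seminorm_top_le_iff ℝ
        (mul_nonneg (by positivity) (apply_nonneg _ _)) i (Φ g)).2 fun x _ => ?_
      have h1 : iteratedFDeriv ℝ i (Φ g) x =
          (iteratedFDeriv ℝ i g (reindex σ x)).compContinuousLinearMap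
            (fun _ => reindex σ) :=
        (reindex σ).iteratedFDeriv_comp_right g.contDiff x (by exact_mod_cast le_top)
      rw [h1]
      refine (ContinuousMultilinearMap.norm_compContinuousLinearMap_le _ _).trans ?_
      rw [Finset.prod_const, Finset.card_univ, Fintype.card_fin, mul_comm]
      gcongr
      exact ContDiffMapSupportedIn.norm_iteratedFDeriv_apply_le_seminorm_top ℝ }

/-- Restriction of a test function along `reindex σ`:
`g ↦ ((x_1,…,x_k) ↦ g(x_{σ 1},…,x_{σ n}))`. -/
def restrict {n k : ℕ} (σ : Fin n → Fin k) (hσ : Function.Surjective σ) :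
    TestFun n →L[ℝ] TestFun k :=
  TestFunction.limitCLM ℝ
    (fun g => ⟨fun x => g (reindex σ x), g.contDiff.comp (reindex σ).contDiff,
      g.hasCompactSupport.comp_isClosedEmbedding (isClosedEmbedding_reindex hσ),
      fun _ _ => trivial⟩)
    (fun K _ => TestFunction.ofSupportedInCLM ℝ (K := reindexCompacts hσ K) (fun _ _ => trivial) ∘L
      restrictSupportedIn hσ K)
    (fun _ _ _ => rfl)

@[simp] theorem restrict_apply {n k : ℕ} (σ : Fin n → Fin k) (hσ : Function.Surjective σ)
    (g : TestFun n) (x : Fin k → Spacetime) :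
    restrict σ hσ g x = g (fun i => x (σ i)) := rfl

/-- For a surjection `σ : {1,…,n} → {1,…,k}` and `S(z_1,…,z_k)`, the distribution on `𝕄ⁿ`
`g ↦ ∫ dz S(z_1,…,z_k) g(z_{σ 1},…,z_{σ n})`, that is, `S` on the partial diagonal
`{x_i = x_{i'} if σ i = σ i'}` times the `δ`-distributions of that diagonal. -/
def onDiagonal {n k : ℕ} (σ : Fin n → Fin k) (hσ : Function.Surjective σ)
    (S : FieldDistribution k) : FieldDistribution n :=
  (restrict σ hσ).precompCompactConvergenceCLM Functional S

@[simp] theorem onDiagonal_apply {n k : ℕ} (σ : Fin n → Fin k) (hσ : Function.Surjective σ)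
    (S : FieldDistribution k) (g : TestFun n) :
    onDiagonal σ hσ S g = S (restrict σ hσ g) := rfl

theorem surjective_snoc_id {n : ℕ} (l : Fin n) :
    Function.Surjective (Fin.snoc (α := fun _ => Fin n) id l : Fin (n + 1) → Fin n) :=
  fun i => ⟨i.castSucc, by simp⟩

/-- `δ(y - x_l) S(x_1,…,x_n)`, a distribution in `(x_1,…,x_n,y)`. -/
def deltaAt {n : ℕ} (l : Fin n) (S : FieldDistribution n) : FieldDistribution (n + 1) :=
  onDiagonal (Fin.snoc (α := fun _ => Fin n) id l) (surjective_snoc_id l) S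

@[simp] theorem deltaAt_apply {n : ℕ} (l : Fin n) (S : FieldDistribution n)
    (g : TestFun (n + 1)) :
    deltaAt l S g = S (restrict (Fin.snoc (α := fun _ => Fin n) id l) (surjective_snoc_id l) g) :=
  rfl

/-- `∂S/∂y^μ` for a distribution `S(x_1,…,x_n,y)`. -/
def dy {n : ℕ} (μ : Fin 4) (S : FieldDistribution (n + 1)) : FieldDistribution (n + 1) :=
  ∂_{(Pi.single (Fin.last n) (e μ) : Fin (n + 1) → Spacetime)} S

/-- Equality of the restrictions to the solutions of the free field equations, `S_0 = S'_0`. -/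
def EqOnShell (m : ℝ) {n : ℕ} (S S' : FieldDistribution n) : Prop :=
  ∀ (g : TestFun n) (s : Config), s.IsOnShell m → S g s = S' g s

/-! ### Time-ordered products and the finite renormalization -/

/-- A sequence of maps `T_n(B_1(x_1) ⊗ ⋯ ⊗ B_n(x_n))`, `n ≥ 1`, with values in the
functional-valued distributions on `𝕄ⁿ`. (The value at `n = 0` plays no role.) -/
abbrev ProductFamily : Type := (n : ℕ) → (Fin n → FieldPoly) → FieldDistribution n

/-- Linearity, initial condition and symmetry. These are three of the axioms of a time-ordered
product; causality and the renormalization conditions are not imposed, so every time-ordered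
product is an instance. -/
structure ProductFamily.IsPreTimeOrdered (T : ProductFamily) : Prop where
  map_add : ∀ (n : ℕ) (B : Fin n → FieldPoly) (l : Fin n) (P Q : FieldPoly),
    T n (Function.update B l (P + Q)) =
      T n (Function.update B l P) + T n (Function.update B l Q)
  map_smul : ∀ (n : ℕ) (B : Fin n → FieldPoly) (l : Fin n) (z : ℂ) (P : FieldPoly),
    T n (Function.update B l (C z * P)) = cmul z (T n (Function.update B l P))
  initial : ∀ (B : FieldPoly) (g : TestFun 1) (s : Config),
    T 1 (fun _ => B) g s = ∫ x : Spacetime, (g (fun _ => x) : ℂ) * evalField B s x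
  symm : ∀ (n : ℕ) (π : Equiv.Perm (Fin n)) (B : Fin n → FieldPoly),
    onDiagonal π.symm π.symm.surjective (T n (fun i => B (π i))) = T n B

/-- The finite renormalization `Z_c`: the distribution `Z_c^{(k)}(B_1(x_1) ⊗ ⋯ ⊗ B_k(x_k))` is
`P(x_1)` times the `δ`-distribution of the thin diagonal, where `P` is the field polynomial
defined here. Thus `Z_c^{(1)}(B(x)) = B(x)`,
`Z_c^{(2)}(B_1(x_1), B_2(x_2)) = c ζ(B_1,B_2)(x_1) δ(x_1-x_2)` and `Z_c^{(k)} = 0` otherwise. -/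
def Z (c : ℝ) : (k : ℕ) → (Fin k → FieldPoly) → FieldPoly
  | 1, B => B 0
  | 2, B => C (c : ℂ) * ζ (B 0) (B 1)
  | _, _ => 0

/-- Partitions of `{1,…,n}` all of whose blocks have one or two elements. -/
def Part₂ (n : ℕ) : Finset (Finpartition (Finset.univ : Finset (Fin n))) :=
  {P | ∀ I ∈ P.parts, I.card ≤ 2}

/-- The number (in an enumeration of the blocks of `P`) of the block that contains `i`. -/
def blockIndex {n : ℕ} (P : Finpartition (Finset.univ : Finset (Fin n))) (i : Fin n) :
    Fin P.parts.card :=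
  P.parts.equivFin ⟨P.part i, P.part_mem.2 (Finset.mem_univ i)⟩

theorem blockIndex_surjective {n : ℕ} (P : Finpartition (Finset.univ : Finset (Fin n))) :
    Function.Surjective (blockIndex P) := by
  intro a
  obtain ⟨I, rfl⟩ := P.parts.equivFin.surjective a
  obtain ⟨i, hi⟩ := P.nonempty_of_mem_parts I.2
  refine ⟨i, congrArg _ (Subtype.ext ?_)⟩
  exact P.part_eq_of_mem I.2 hi

/-- The field polynomial `Z_c^{(|I|)}(⊗_{j ∈ I} B_j)` for the block `I` of `P` with number `a`. -/
def blockField (c : ℝ) {n : ℕ} (B : Fin n → FieldPoly)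
    (P : Finpartition (Finset.univ : Finset (Fin n))) (a : Fin P.parts.card) : FieldPoly :=
  let I : Finset (Fin n) := (P.parts.equivFin.symm a : Finset (Fin n))
  Z c I.card fun r => B (I.orderEmbOfFin rfl r)

/-- `T_{|P|}(⊗_{I ∈ P} Z_c^{(|I|)}(⊗_{j ∈ I} B_j(x_j)))`. -/
def insertZ (c : ℝ) (T : ProductFamily) {n : ℕ} (B : Fin n → FieldPoly)
    (P : Finpartition (Finset.univ : Finset (Fin n))) : FieldDistribution n :=
  onDiagonal (blockIndex P) (blockIndex_surjective P) (T P.parts.card (blockField c B P))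

/-- The renormalized product `T̂_c`:
`i^n T̂_{c,n}(⊗_j B_j(x_j)) = ∑_{P ∈ Part₂} i^{|P|} T_{|P|}(⊗_{I ∈ P} Z_c^{(|I|)}(⊗_{j ∈ I} B_j(x_j)))`,
where the partition into singletons gives the term `i^n T_n(⊗_j B_j(x_j))`. -/
def hatT (c : ℝ) (T : ProductFamily) : ProductFamily := fun n B =>
  cmul (Complex.I ^ n)⁻¹
    (∑ P ∈ Part₂ n, cmul (Complex.I ^ P.parts.card) (insertZ c T B P))

/-! ### The Ward identities -/

/-- `∂_y^μ T_{n+1}(B_1(x_1) ⊗ ⋯ ⊗ B_n(x_n) ⊗ j_μ(y))`, using `∂^μ j_μ = ∂_μ j^μ`. -/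
def divCurrent (T : ProductFamily) (n : ℕ) (B : Fin n → FieldPoly) : FieldDistribution (n + 1) :=
  ∑ μ : Fin 4, dy μ (T (n + 1) (Fin.snoc (α := fun _ => FieldPoly) B (j μ)))

/-- `∑_l δ(y - x_l) T_n(B_1(x_1) ⊗ ⋯ ⊗ (θ B_l)(x_l) ⊗ ⋯ ⊗ B_n(x_n))`. -/
def thetaTerm (T : ProductFamily) (n : ℕ) (B : Fin n → FieldPoly) : FieldDistribution (n + 1) :=
  ∑ l : Fin n, deltaAt l (T n (Function.update B l (θ (B l))))

/-- `∂_y^μ (∑_l δ(y - x_l) T_n(B_1(x_1) ⊗ ⋯ ⊗ (θ_μ B_l)(x_l) ⊗ ⋯ ⊗ B_n(x_n)))`, where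
`∂^μ = g^{μμ} ∂_μ`. -/
def thetaLowTerm (T : ProductFamily) (n : ℕ) (B : Fin n → FieldPoly) :
    FieldDistribution (n + 1) :=
  ∑ μ : Fin 4, η μ • dy μ (∑ l : Fin n, deltaAt l (T n (Function.update B l (θlow μ (B l)))))

/-- The on-shell Master Ward Identity for `T` at `(B_1,…,B_n)`. -/
def MWI (m : ℝ) (T : ProductFamily) (n : ℕ) (B : Fin n → FieldPoly) : Prop :=
  EqOnShell m (divCurrent T n B) (thetaTerm T n B - thetaLowTerm T n B)

/-- The naive on-shell Ward identity for `T` at `(B_1,…,B_n)`. -/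
def NaiveWI (m : ℝ) (T : ProductFamily) (n : ℕ) (B : Fin n → FieldPoly) : Prop :=
  EqOnShell m (divCurrent T n B) (thetaTerm T n B)

/-- The `c`-dependent on-shell Ward identity for `T` at `(B_1,…,B_n)`. -/
def WI (m c : ℝ) (T : ProductFamily) (n : ℕ) (B : Fin n → FieldPoly) : Prop :=
  EqOnShell m (divCurrent T n B) (thetaTerm T n B + (c - 1) • thetaLowTerm T n B)

end ScalarQED

end

noncomputable section

namespace ScalarQED

open MvPolynomial FieldSymbol

/-! ### Algebra of field polynomials -/

/-! The violation of (WI-c) by `hatT c T` is a sum over partitions of the violations of the Master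
Ward Identity by `T` at the block fields, and this relation is triangular in the order.

A partition of the points `x_1, …, x_n, y` into blocks of size at most two arises from a partition
`P` of the `x_l` by leaving `y` alone or by joining it to a singleton `{x_l}`. The first case
reproduces `T` with the current inserted next to the block fields of `P`. In the second, `ζ_j` turns
`ζ(B_l, j^μ)` into `i η_μ θ_μ B_l`. The number of blocks is then smaller by one, and the factor `i`
from `ζ_j` compensates the missing power of `i`. Taking the divergence adds exactly `c` times the
`θ_μ` term of `hatT c T` (`divCurrent_hatT`).

The other two terms pass through the sum over partitions unchanged. For `θ` this holds because it
obeys the Leibniz rule on `ζ` (`θ_ζ`). For `θ_μ` every contribution of a pair vanishes, since `θ_μ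
B_l` and `ζ(B_l, B_l')` contain no derivated field. The `θ_μ` coefficient `c - (c - 1) = 1` that
remains is that of the Master Ward Identity (`WI_iff_blockSum_anomaly`).

The partition into singletons contributes the violation for `T` at `(B_1, …, B_n)` itself. All
others have fewer blocks, whose fields are again admissible (`Admissible.C_mul_ζ`), so strong
induction on `n` gives the equivalence.

Partitions are encoded by involutions, for which adjoining a point is explicit. Symmetry of `T`
makes the numbering of blocks irrelevant. -/

theorem pderiv_comm (a b : FieldSymbol) (B : FieldPoly) :
    pderiv a (pderiv b B) = pderiv b (pderiv a B) := by
  classical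
  have h : ⁅pderiv a, pderiv b⁆ = (0 : Derivation ℂ FieldPoly FieldPoly) :=
    MvPolynomial.derivation_ext fun x => by
      rw [Derivation.commutator_apply]
      simp only [pderiv_X, Pi.single_apply]
      split_ifs <;> simp
  have := congrArg (fun D : Derivation ℂ FieldPoly FieldPoly => D B) h
  rwa [Derivation.commutator_apply, Derivation.zero_apply, sub_eq_zero] at this

theorem θ_mul (P Q : FieldPoly) : θ (P * Q) = θ P * Q + P * θ Q := by
  have h (s : FieldSymbol) : pderiv s (P * Q) = pderiv s P * Q + P * pderiv s Q := by
    rw [pderiv_mul]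
  simp only [θ, h, Fin.sum_univ_four]
  ring

theorem θ_add (P Q : FieldPoly) : θ (P + Q) = θ P + θ Q := by
  simp only [θ, map_add, Fin.sum_univ_four]
  ring

theorem θ_C (z : ℂ) : θ (C z) = 0 := by simp [θ]

theorem θ_C_mul (z : ℂ) (P : FieldPoly) : θ (C z * P) = C z * θ P := by
  rw [θ_mul, θ_C, zero_mul, zero_add]

theorem θ_sum {ι : Type*} (s : Finset ι) (P : ι → FieldPoly) :
    θ (∑ i ∈ s, P i) = ∑ i ∈ s, θ (P i) :=
  map_sum (AddMonoidHom.mk' θ θ_add) P s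

/-- Differentiating by a field of charge one lowers the charge by one; for `φ^*` below, it raises
the charge by one. -/
theorem θ_pderiv_dphi (μ : Fin 4) (P : FieldPoly) :
    θ (pderiv (dphi μ) P) = pderiv (dphi μ) (θ P) - pderiv (dphi μ) P := by
  classical
  simp only [θ, map_add, map_sub, map_sum, pderiv_mul, pderiv_X, Pi.single_apply, reduceCtorEq,
    if_false, FieldSymbol.dphi.injEq, zero_mul, zero_add, ite_mul, one_mul, Finset.sum_add_distrib,
    Finset.sum_ite_eq', Finset.mem_univ, if_true, pderiv_comm (dphi μ)]
  ring

theorem θ_pderiv_dphiStar (μ : Fin 4) (P : FieldPoly) :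
    θ (pderiv (dphiStar μ) P) = pderiv (dphiStar μ) (θ P) + pderiv (dphiStar μ) P := by
  classical
  simp only [θ, map_add, map_sub, map_sum, pderiv_mul, pderiv_X, Pi.single_apply, reduceCtorEq,
    if_false, FieldSymbol.dphiStar.injEq, zero_mul, zero_add, ite_mul, one_mul,
    Finset.sum_add_distrib, Finset.sum_ite_eq', Finset.mem_univ, if_true,
    pderiv_comm (dphiStar μ)]
  ring

theorem ζ_comm (P Q : FieldPoly) : ζ P Q = ζ Q P := by
  simp only [ζ]
  exact Finset.sum_congr rfl fun μ _ => by ring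

theorem ζ_add_left (P P' Q : FieldPoly) : ζ (P + P') Q = ζ P Q + ζ P' Q := by
  simp only [ζ, map_add, ← Finset.sum_add_distrib]
  exact Finset.sum_congr rfl fun μ _ => by ring

theorem ζ_C_mul_left (z : ℂ) (P Q : FieldPoly) : ζ (C z * P) Q = C z * ζ P Q := by
  simp only [ζ, pderiv_C_mul, Finset.mul_sum]
  exact Finset.sum_congr rfl fun μ _ => by ring

theorem ζ_C_mul_right (z : ℂ) (P Q : FieldPoly) : ζ P (C z * Q) = C z * ζ P Q := by
  rw [ζ_comm, ζ_C_mul_left, ζ_comm]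

/-- Each summand of `ζ` strips one field of charge `+1` and one of charge `-1`, so the two
commutator corrections cancel. -/
theorem θ_ζ (P Q : FieldPoly) : θ (ζ P Q) = ζ (θ P) Q + ζ P (θ Q) := by
  simp only [ζ, θ_sum, θ_C, θ_add, θ_mul, θ_pderiv_dphi, θ_pderiv_dphiStar,
    ← Finset.sum_add_distrib]
  exact Finset.sum_congr rfl fun μ _ => by ring

/-- The current is linear in the derivated fields, with coefficients `iφ` and `-iφ^*`; these are the
coefficients in `θ_μ`, up to `i` and the metric sign from lowering the index. -/
theorem ζ_j (P : FieldPoly) (ν : Fin 4) :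
    ζ P (j ν) = C (Complex.I * (η ν : ℂ)) * θlow ν P := by
  classical
  have h1 (μ : Fin 4) : pderiv (dphi μ) (j ν) =
      if μ = ν then -(C Complex.I * X phiStar) else 0 := by
    simp only [j, pderiv_C, map_sub, pderiv_mul, pderiv_X, Pi.single_apply, reduceCtorEq,
      if_false, FieldSymbol.dphi.injEq, eq_comm (a := ν)]
    split_ifs <;> ring
  have h2 (μ : Fin 4) : pderiv (dphiStar μ) (j ν) =
      if μ = ν then C Complex.I * X phi else 0 := by
    simp only [j, pderiv_C, map_sub, pderiv_mul, pderiv_X, Pi.single_apply, reduceCtorEq,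
      if_false, FieldSymbol.dphiStar.injEq, eq_comm (a := ν)]
    split_ifs <;> ring
  rw [ζ, Finset.sum_eq_single ν (fun μ _ h => by simp [h1, h2, h]) (by simp)]
  simp only [h1, h2, if_true, θlow, C_mul]
  ring

/-- `P` contains no derivated basic field. -/
def NoDerivative (P : FieldPoly) : Prop :=
  ∀ μ : Fin 4, pderiv (dphi μ) P = 0 ∧ pderiv (dphiStar μ) P = 0

theorem NoDerivative.ζ_left {P : FieldPoly} (h : NoDerivative P) (Q : FieldPoly) :
    ζ P Q = 0 := by
  simp [ζ, (h _).1, (h _).2]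

theorem NoDerivative.θlow {P : FieldPoly} (h : NoDerivative P) (μ : Fin 4) :
    θlow μ P = 0 := by
  simp [ScalarQED.θlow, (h μ).1, (h μ).2]

theorem NoDerivative.atMostOneDerivative {P : FieldPoly} (h : NoDerivative P) :
    AtMostOneDerivative P := fun μ ν => by
  simp [(h ν).1, (h ν).2]

theorem NoDerivative.C_mul {P : FieldPoly} (h : NoDerivative P) (z : ℂ) :
    NoDerivative (C z * P) := fun μ => by
  simp [(h μ).1, (h μ).2]

/-- `θ_μ` trades the only derivated field of a monomial for an underivated one. -/
theorem AtMostOneDerivative.noDerivative_θlow {P : FieldPoly} (h : AtMostOneDerivative P)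
    (μ : Fin 4) : NoDerivative (ScalarQED.θlow μ P) := fun ν => by
  classical
  simp [ScalarQED.θlow, pderiv_X, (h _ _).1, (h _ _).2.1,
    (h _ _).2.2, pderiv_comm (dphi ν) (dphiStar μ)]

theorem AtMostOneDerivative.noDerivative_ζ {P Q : FieldPoly} (hP : AtMostOneDerivative P)
    (hQ : AtMostOneDerivative Q) : NoDerivative (ζ P Q) := fun ν => by
  simp [ζ, (hP _ _).1, (hP _ _).2.1, (hP _ _).2.2, (hQ _ _).1,
    (hQ _ _).2.1, (hQ _ _).2.2, pderiv_comm (dphi ν) (dphiStar _)]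

/-- Charges add under `ζ`, and both derivated fields are used up. This closure lets an induction
hypothesis be applied to the block fields. -/
theorem Admissible.C_mul_ζ {P Q : FieldPoly} (hP : Admissible P) (hQ : Admissible Q) (z : ℂ) :
    Admissible (C z * ζ P Q) := by
  obtain ⟨⟨b, hb⟩, hP⟩ := hP
  obtain ⟨⟨b', hb'⟩, hQ⟩ := hQ
  refine ⟨⟨b + b', ?_⟩, ((hP.noDerivative_ζ hQ).C_mul z).atMostOneDerivative⟩
  rw [θ_C_mul, θ_ζ, hb, hb', ζ_C_mul_left, ζ_C_mul_right]
  simp only [Int.cast_add, map_add]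
  ring

/-! ### Distributions on diagonals -/

theorem fieldDistribution_ext {n : ℕ} {S S' : FieldDistribution n}
    (h : ∀ g s, S g s = S' g s) : S = S' := by
  ext g s
  exact h g s

theorem onDiagonal_onDiagonal {n k p : ℕ} {σ : Fin n → Fin k} (hσ : Function.Surjective σ)
    {τ : Fin k → Fin p} (hτ : Function.Surjective τ) (S : FieldDistribution p) :
    onDiagonal σ hσ (onDiagonal τ hτ S) = onDiagonal (τ ∘ σ) (hτ.comp hσ) S := rfl

theorem onDiagonal_congr {n k : ℕ} {σ σ' : Fin n → Fin k} (hσ : Function.Surjective σ)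
    (h : σ = σ') (S : FieldDistribution k) :
    onDiagonal σ hσ S = onDiagonal σ' (h ▸ hσ) S := by
  subst h; rfl

/-- `σ : {1,…,n} → {1,…,k}`, extended by mapping the additional last index to the last index. -/
def extendLast {n k : ℕ} (σ : Fin n → Fin k) : Fin (n + 1) → Fin (k + 1) :=
  Fin.snoc (α := fun _ => Fin (k + 1)) (fun i => (σ i).castSucc) (Fin.last k)

@[simp] theorem extendLast_castSucc {n k : ℕ} (σ : Fin n → Fin k) (i : Fin n) :
    extendLast σ i.castSucc = (σ i).castSucc := by simp [extendLast]

@[simp] theorem extendLast_last {n k : ℕ} (σ : Fin n → Fin k) :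
    extendLast σ (Fin.last n) = Fin.last k := by simp [extendLast]

theorem surjective_extendLast {n k : ℕ} {σ : Fin n → Fin k} (hσ : Function.Surjective σ) :
    Function.Surjective (extendLast σ) := by
  intro a
  induction a using Fin.lastCases with
  | last => exact ⟨Fin.last n, by simp⟩
  | cast a =>
    obtain ⟨i, rfl⟩ := hσ a
    exact ⟨i.castSucc, by simp⟩

theorem surjective_snoc {n k : ℕ} {σ : Fin n → Fin k} (hσ : Function.Surjective σ) (a : Fin k) :
    Function.Surjective (Fin.snoc (α := fun _ => Fin k) σ a : Fin (n + 1) → Fin k) := by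
  intro b
  obtain ⟨i, rfl⟩ := hσ b
  exact ⟨i.castSucc, by simp⟩

/-- Gluing `y` to `x_l` after the `x_i` have been glued into blocks is gluing `y` to the block of
`l`. With `onDiagonal_deltaAt`, both orders of gluing reach the same normal form. -/
theorem deltaAt_onDiagonal {n k : ℕ} {σ : Fin n → Fin k} (hσ : Function.Surjective σ) (l : Fin n)
    (S : FieldDistribution k) :
    deltaAt l (onDiagonal σ hσ S) =
      onDiagonal (Fin.snoc (α := fun _ => Fin k) σ (σ l)) (surjective_snoc hσ _) S := by
  rw [deltaAt, onDiagonal_onDiagonal]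
  refine onDiagonal_congr _ (funext fun i => ?_) S
  induction i using Fin.lastCases <;> simp

theorem onDiagonal_deltaAt {n k : ℕ} {σ : Fin n → Fin k} (hσ : Function.Surjective σ) (a : Fin k)
    (S : FieldDistribution k) :
    onDiagonal (extendLast σ) (surjective_extendLast hσ) (deltaAt a S) =
      onDiagonal (Fin.snoc (α := fun _ => Fin k) σ a) (surjective_snoc hσ _) S := by
  rw [deltaAt, onDiagonal_onDiagonal]
  refine onDiagonal_congr _ (funext fun i => ?_) S
  induction i using Fin.lastCases <;> simp

theorem dy_onDiagonal {n k : ℕ} {σ : Fin n → Fin k} (hσ : Function.Surjective σ) (μ : Fin 4)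
    (S : FieldDistribution (k + 1)) :
    dy μ (onDiagonal (extendLast σ) (surjective_extendLast hσ) S) =
      onDiagonal (extendLast σ) (surjective_extendLast hσ) (dy μ S) := by
  -- Only the last index is sent to the last index, so a shift of `y` alone remains a shift of `y`
  -- alone; hence `∂_y` commutes with restricting test functions.
  have hv : reindex (extendLast σ) (Pi.single (Fin.last k) (e μ)) =
      Pi.single (Fin.last n) (e μ) := by
    funext i
    induction i using Fin.lastCases <;> simp
  have hg (g : TestFun (n + 1)) :
      ∂_{(Pi.single (Fin.last k) (e μ) : Fin (k + 1) → Spacetime)}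
          (restrict (extendLast σ) (surjective_extendLast hσ) g) =
        restrict (extendLast σ) (surjective_extendLast hσ)
          (∂_{(Pi.single (Fin.last n) (e μ) : Fin (n + 1) → Spacetime)} g) := by
    refine DFunLike.ext _ _ fun x => ?_
    rw [TestFunction.lineDerivOp_eq_lineDerivCLM ℝ, TestFunction.lineDerivOp_eq_lineDerivCLM ℝ,
      restrict_apply, TestFunction.lineDerivCLM_apply_of_le (by simp),
      TestFunction.lineDerivCLM_apply_of_le (by simp), ← hv]
    simp only [lineDeriv, restrict_apply, Pi.add_apply, Pi.smul_apply]
    rfl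
  refine fieldDistribution_ext fun g s => ?_
  simp only [dy, onDiagonal_apply, Distribution.lineDerivOp_apply_apply, map_neg, hg]

/-! ### Linearity of the operations on distributions -/

theorem onDiagonal_add {n k : ℕ} {σ : Fin n → Fin k} (hσ : Function.Surjective σ)
    (S S' : FieldDistribution k) :
    onDiagonal σ hσ (S + S') = onDiagonal σ hσ S + onDiagonal σ hσ S' := rfl

theorem onDiagonal_sum {n k : ℕ} {σ : Fin n → Fin k} (hσ : Function.Surjective σ)
    {ι : Type*} (s : Finset ι) (S : ι → FieldDistribution k) :
    onDiagonal σ hσ (∑ i ∈ s, S i) = ∑ i ∈ s, onDiagonal σ hσ (S i) :=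
  map_sum ((restrict σ hσ).precompCompactConvergenceCLM Functional) S s

theorem onDiagonal_cmul {n k : ℕ} {σ : Fin n → Fin k} (hσ : Function.Surjective σ)
    (z : ℂ) (S : FieldDistribution k) :
    onDiagonal σ hσ (cmul z S) = cmul z (onDiagonal σ hσ S) := rfl

theorem cmul_add {n : ℕ} (z : ℂ) (S S' : FieldDistribution n) :
    cmul z (S + S') = cmul z S + cmul z S' :=
  map_add (Distribution.mapCLM (z • ContinuousLinearMap.id ℝ Functional)) S S'

theorem cmul_sum {n : ℕ} (z : ℂ) {ι : Type*} (s : Finset ι) (S : ι → FieldDistribution n) :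
    cmul z (∑ i ∈ s, S i) = ∑ i ∈ s, cmul z (S i) :=
  map_sum (Distribution.mapCLM (z • ContinuousLinearMap.id ℝ Functional)) S s

theorem cmul_cmul {n : ℕ} (z w : ℂ) (S : FieldDistribution n) :
    cmul z (cmul w S) = cmul (z * w) S :=
  fieldDistribution_ext fun g s => by simp [mul_assoc]

theorem cmul_zero_left {n : ℕ} (S : FieldDistribution n) : cmul 0 S = 0 :=
  fieldDistribution_ext fun g s => by simp

theorem cmul_zero {n : ℕ} (z : ℂ) : cmul z (0 : FieldDistribution n) = 0 :=
  fieldDistribution_ext fun g s => by simp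

theorem cmul_one_left {n : ℕ} (S : FieldDistribution n) : cmul 1 S = S :=
  fieldDistribution_ext fun g s => by simp

theorem cmul_ofReal {n : ℕ} (r : ℝ) (S : FieldDistribution n) : cmul (r : ℂ) S = r • S :=
  fieldDistribution_ext fun g s => by
    rw [cmul_apply, ← Complex.real_smul]
    rfl

theorem dy_add {n : ℕ} (μ : Fin 4) (S S' : FieldDistribution (n + 1)) :
    dy μ (S + S') = dy μ S + dy μ S' :=
  map_add (Distribution.lineDerivCLM _) S S'

theorem dy_sum {n : ℕ} (μ : Fin 4) {ι : Type*} (s : Finset ι)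
    (S : ι → FieldDistribution (n + 1)) : dy μ (∑ i ∈ s, S i) = ∑ i ∈ s, dy μ (S i) :=
  map_sum (Distribution.lineDerivCLM _) S s

theorem dy_cmul {n : ℕ} (μ : Fin 4) (z : ℂ) (S : FieldDistribution (n + 1)) :
    dy μ (cmul z S) = cmul z (dy μ S) :=
  fieldDistribution_ext fun g s => by
    simp only [dy, Distribution.lineDerivOp_apply_apply, cmul_apply]

/-! ### Partitions into singletons and pairs, and involutions -/

/-- Involutions of `{1,…,n}`; the orbits are the blocks of a partition in `Part₂ n`. -/
abbrev Invol (n : ℕ) : Type := {f : Fin n → Fin n // Function.Involutive f}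

instance (n : ℕ) : Fintype (Invol n) := Fintype.ofFinite _

/-- The orbit relation of an involution. -/
def Invol.setoid {n : ℕ} (f : Invol n) : Setoid (Fin n) where
  r i i' := i' = i ∨ i' = f.1 i
  iseqv :=
    { refl := fun _ => .inl rfl
      symm := by
        rintro i _ (rfl | rfl)
        · exact .inl rfl
        · exact .inr (f.2 i).symm
      trans := by
        rintro i _ _ (rfl | rfl) (rfl | rfl)
        · exact .inl rfl
        · exact .inr rfl
        · exact .inr rfl
        · exact .inl (f.2 i) }

open Classical in
/-- The partition into the orbits of an involution. -/
def Invol.partition {n : ℕ} (f : Invol n) : Finpartition (Finset.univ : Finset (Fin n)) :=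
  Finpartition.ofSetoid f.setoid

theorem Invol.part_partition {n : ℕ} (f : Invol n) (i : Fin n) :
    f.partition.part i = {i, f.1 i} := by
  classical
  ext i'
  rw [Invol.partition, Finpartition.mem_part_ofSetoid_iff_rel, Finset.mem_insert,
    Finset.mem_singleton]
  rfl

theorem finpartition_ext_part {n : ℕ} {P Q : Finpartition (Finset.univ : Finset (Fin n))}
    (h : ∀ i, P.part i = Q.part i) : P = Q := by
  have key {P Q : Finpartition (Finset.univ : Finset (Fin n))}
      (h : ∀ i, P.part i = Q.part i) : P.parts ⊆ Q.parts := fun I hI => by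
    obtain ⟨i, hi⟩ := P.nonempty_of_mem_parts hI
    rw [← P.part_eq_of_mem hI hi, h]
    exact Q.part_mem.2 (Finset.mem_univ i)
  exact Finpartition.ext ((key h).antisymm (key fun i => (h i).symm))

theorem Invol.partition_injective {n : ℕ} :
    Function.Injective (Invol.partition : Invol n → _) := fun f g h => by
  refine Subtype.ext (funext fun i => ?_)
  have hi : ({i, f.1 i} : Finset (Fin n)) = {i, g.1 i} := by
    rw [← f.part_partition, h, g.part_partition]
  have h1 : f.1 i ∈ ({i, g.1 i} : Finset (Fin n)) := hi ▸ by simp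
  have h2 : g.1 i ∈ ({i, f.1 i} : Finset (Fin n)) := hi ▸ by simp
  simp only [Finset.mem_insert, Finset.mem_singleton] at h1 h2
  grind

theorem Invol.exists_partition_eq {n : ℕ} {P : Finpartition (Finset.univ : Finset (Fin n))}
    (hP : P ∈ Part₂ n) : ∃ f : Invol n, f.partition = P := by
  have hP' : ∀ I ∈ P.parts, I.card ≤ 2 := by simpa [Part₂] using hP
  have hex (i : Fin n) : ∃ k, P.part i = {i, k} := by
    have hi : i ∈ P.part i := P.mem_part_self.2 (Finset.mem_univ i)
    have hc := hP' _ (P.part_mem.2 (Finset.mem_univ i))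
    have hc' := Finset.card_erase_add_one hi
    have : Nonempty (Fin n) := ⟨i⟩
    have hle : ((P.part i).erase i).card ≤ 1 := by omega
    rcases Finset.card_le_one_iff_subset_singleton.1 hle with ⟨k, hk⟩
    rcases Finset.subset_singleton_iff.1 hk with h | h
    -- In a singleton block, `i` is its own partner.
    · exact ⟨i, by rw [← Finset.insert_erase hi, h]; simp⟩
    · exact ⟨k, by rw [← Finset.insert_erase hi, h]⟩
  choose f hf using hex
  have hinv : Function.Involutive f := fun i => by
    have h : P.part (f i) = P.part i :=
      P.part_eq_of_mem (P.part_mem.2 (Finset.mem_univ i)) (by simp [hf i])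
    rw [hf, hf] at h
    have h1 : f (f i) ∈ ({i, f i} : Finset (Fin n)) := h ▸ by simp
    have h2 : i ∈ ({f i, f (f i)} : Finset (Fin n)) := h ▸ by simp
    simp only [Finset.mem_insert, Finset.mem_singleton] at h1 h2
    grind
  exact ⟨⟨f, hinv⟩, finpartition_ext_part fun i => by rw [Invol.part_partition, hf]⟩

theorem Invol.partition_mem {n : ℕ} (f : Invol n) : f.partition ∈ Part₂ n := by
  simp only [Part₂, Finset.mem_filter, Finset.mem_univ, true_and]
  intro I hI
  obtain ⟨i, hi⟩ := f.partition.nonempty_of_mem_parts hI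
  rw [← f.partition.part_eq_of_mem hI hi, f.part_partition]
  exact Finset.card_le_two

theorem sum_part₂ {n : ℕ} {M : Type*} [AddCommMonoid M]
    (G : Finpartition (Finset.univ : Finset (Fin n)) → M) :
    ∑ P ∈ Part₂ n, G P = ∑ f : Invol n, G f.partition := by
  symm
  refine Finset.sum_bij (fun f _ => f.partition) (fun f _ => f.partition_mem)
    (fun f _ g _ h => Invol.partition_injective h) (fun P hP => ?_) (fun _ _ => rfl)
  obtain ⟨f, hf⟩ := Invol.exists_partition_eq hP
  exact ⟨f, Finset.mem_univ _, hf⟩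

/-- `σ` numbers the orbits of `f`. -/
structure IsBlockMap {n k : ℕ} (f : Invol n) (σ : Fin n → Fin k) : Prop where
  surjective : Function.Surjective σ
  eq_iff : ∀ i i', σ i = σ i' ↔ i' = i ∨ i' = f.1 i

theorem isBlockMap_blockIndex {n : ℕ} (f : Invol n) : IsBlockMap f (blockIndex f.partition) where
  surjective := blockIndex_surjective _
  eq_iff i i' := by
    rw [blockIndex, blockIndex, EmbeddingLike.apply_eq_iff_eq, Subtype.mk.injEq]
    have := f.partition.mem_part_iff_part_eq_part (Finset.mem_univ i') (Finset.mem_univ i)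
    rw [eq_comm, ← this, f.part_partition, Finset.mem_insert, Finset.mem_singleton]

/-- The field polynomial `Z_c` of the orbit of `i`. -/
def pairField (c : ℝ) {n : ℕ} (B : Fin n → FieldPoly) (f : Invol n) (i : Fin n) : FieldPoly :=
  if f.1 i = i then B i else C (c : ℂ) * ζ (B i) (B (f.1 i))

/-- `Z` is defined by cases on the cardinality, which must become a literal before it can reduce. -/
theorem Z_card_eq (c : ℝ) {n k : ℕ} (B : Fin n → FieldPoly) (I : Finset (Fin n))
    (h : I.card = k) :
    (Z c I.card fun r => B (I.orderEmbOfFin rfl r)) = Z c k fun r => B (I.orderEmbOfFin h r) := by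
  subst h; rfl

theorem Z_singleton (c : ℝ) {n : ℕ} (B : Fin n → FieldPoly) {I : Finset (Fin n)} {i : Fin n}
    (hI : I = {i}) : (Z c I.card fun r => B (I.orderEmbOfFin rfl r)) = B i := by
  subst hI
  rw [Z_card_eq c B {i} (Finset.card_singleton i)]
  simp [Z]

/-- The increasing enumeration may list the two points in either order; symmetry of `ζ` makes this
harmless. -/
theorem Z_pair (c : ℝ) {n : ℕ} (B : Fin n → FieldPoly) {I : Finset (Fin n)} {i i' : Fin n}
    (h : i ≠ i') (hI : I = {i, i'}) :
    (Z c I.card fun r => B (I.orderEmbOfFin rfl r)) = C (c : ℂ) * ζ (B i) (B i') := by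
  subst hI
  have hc := Finset.card_pair h
  rw [Z_card_eq c B _ hc]
  change C (c : ℂ) * ζ (B (Finset.orderEmbOfFin _ hc 0)) (B (Finset.orderEmbOfFin _ hc 1)) = _
  have h0 := Finset.orderEmbOfFin_mem _ hc 0
  have h1 := Finset.orderEmbOfFin_mem _ hc 1
  have hne : Finset.orderEmbOfFin _ hc 0 ≠ Finset.orderEmbOfFin _ hc 1 := by simp
  simp only [Finset.mem_insert, Finset.mem_singleton] at h0 h1
  rcases h0 with h0 | h0 <;> rcases h1 with h1 | h1
  · exact absurd (h0.trans h1.symm) hne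
  · rw [h0, h1]
  · rw [h0, h1, ζ_comm]
  · exact absurd (h0.trans h1.symm) hne

theorem blockField_blockIndex (c : ℝ) {n : ℕ} (B : Fin n → FieldPoly) (f : Invol n) (i : Fin n) :
    blockField c B f.partition (blockIndex f.partition i) = pairField c B f i := by
  have h : (f.partition.parts.equivFin.symm (blockIndex f.partition i) : Finset (Fin n)) =
      {i, f.1 i} := by
    rw [blockIndex, Equiv.symm_apply_apply]
    exact f.part_partition i
  rw [pairField]
  split_ifs with hi
  · exact Z_singleton c B (by rw [h, hi, Finset.pair_eq_singleton])
  · exact Z_pair c B (Ne.symm hi) h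

theorem hatT_eq_sum_invol (c : ℝ) (T : ProductFamily) (n : ℕ) (B : Fin n → FieldPoly) :
    hatT c T n B = cmul (Complex.I ^ n)⁻¹ (∑ f : Invol n,
      cmul (Complex.I ^ f.partition.parts.card) (insertZ c T B f.partition)) := by
  rw [hatT, sum_part₂]

/-! ### Relabelling of blocks -/

theorem exists_equiv_of_surjective {n k k' : ℕ} {σ : Fin n → Fin k} {σ' : Fin n → Fin k'}
    (hσ : Function.Surjective σ) (hσ' : Function.Surjective σ')
    (h : ∀ i i', σ i = σ i' ↔ σ' i = σ' i') :
    ∃ e : Fin k ≃ Fin k', ∀ i, e (σ i) = σ' i := by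
  have he (i : Fin n) : σ' (Function.surjInv hσ (σ i)) = σ' i :=
    (h _ _).1 (Function.surjInv_eq hσ _)
  refine ⟨Equiv.ofBijective (fun a => σ' (Function.surjInv hσ a)) ⟨fun a b hab => ?_, fun b => ?_⟩,
    he⟩
  · have := (h _ _).2 hab
    rwa [Function.surjInv_eq hσ, Function.surjInv_eq hσ] at this
  · obtain ⟨i, rfl⟩ := hσ' b
    exact ⟨σ i, he i⟩

/-- Two numberings of the same blocks differ by a permutation, which the symmetry of `T` absorbs. -/
theorem ProductFamily.IsPreTimeOrdered.onDiagonal_congr {T : ProductFamily}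
    (hT : T.IsPreTimeOrdered) {n k k' : ℕ} {σ : Fin n → Fin k} {σ' : Fin n → Fin k'}
    (hσ : Function.Surjective σ) (hσ' : Function.Surjective σ')
    (h : ∀ i i', σ i = σ i' ↔ σ' i = σ' i') {F : Fin k → FieldPoly} {F' : Fin k' → FieldPoly}
    (hF : ∀ i, F (σ i) = F' (σ' i)) :
    onDiagonal σ hσ (T k F) = onDiagonal σ' hσ' (T k' F') := by
  obtain ⟨e, he⟩ := exists_equiv_of_surjective hσ hσ' h
  obtain rfl : k = k' := by simpa using Fintype.card_congr e
  have hF' : F = fun a => F' (e a) := funext fun a => by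
    obtain ⟨i, rfl⟩ := hσ a
    rw [hF, he]
  rw [← hT.symm k e F', onDiagonal_onDiagonal, hF']
  exact ScalarQED.onDiagonal_congr _
    (funext fun i => by rw [Function.comp_apply, ← he, Equiv.symm_apply_apply]) _

theorem IsBlockMap.card_parts {n k : ℕ} {f : Invol n} {σ : Fin n → Fin k} (h : IsBlockMap f σ) :
    f.partition.parts.card = k := by
  obtain ⟨e, -⟩ := exists_equiv_of_surjective (isBlockMap_blockIndex f).surjective h.surjective
    fun i i' => by rw [h.eq_iff, (isBlockMap_blockIndex f).eq_iff]
  simpa using Fintype.card_congr e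

/-- Frees computations from the arbitrary enumeration in `blockIndex`: any convenient numbering of
the orbits may be used. -/
theorem IsBlockMap.insertZ_eq {T : ProductFamily} (hT : T.IsPreTimeOrdered) {c : ℝ} {n k : ℕ}
    {B : Fin n → FieldPoly} {f : Invol n} {σ : Fin n → Fin k} (h : IsBlockMap f σ)
    {F : Fin k → FieldPoly} (hF : ∀ i, F (σ i) = pairField c B f i) :
    insertZ c T B f.partition = onDiagonal σ h.surjective (T k F) :=
  hT.onDiagonal_congr _ _
    (fun i i' => by rw [h.eq_iff, (isBlockMap_blockIndex f).eq_iff])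
    fun i => by rw [blockField_blockIndex, hF]

/-! ### Multilinearity -/

/-- The field polynomial of the orbit of `l`, as a function of the field polynomial at `l`. -/
def slotField (c : ℝ) {n : ℕ} (B : Fin n → FieldPoly) (f : Invol n) (l : Fin n) (P : FieldPoly) :
    FieldPoly :=
  if f.1 l = l then P else C (c : ℂ) * ζ P (B (f.1 l))

theorem slotField_add (c : ℝ) {n : ℕ} (B : Fin n → FieldPoly) (f : Invol n) (l : Fin n)
    (P Q : FieldPoly) :
    slotField c B f l (P + Q) = slotField c B f l P + slotField c B f l Q := by
  unfold slotField
  split_ifs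
  · rfl
  · rw [ζ_add_left, mul_add]

theorem slotField_C_mul (c : ℝ) {n : ℕ} (B : Fin n → FieldPoly) (f : Invol n) (l : Fin n) (z : ℂ)
    (P : FieldPoly) : slotField c B f l (C z * P) = C z * slotField c B f l P := by
  unfold slotField
  split_ifs
  · rfl
  · rw [ζ_C_mul_left, mul_left_comm]

theorem pairField_update_of_mem (c : ℝ) {n : ℕ} (B : Fin n → FieldPoly) (f : Invol n)
    {i l : Fin n} (h : l = i ∨ l = f.1 i) (P : FieldPoly) :
    pairField c (Function.update B l P) f i = slotField c B f l P := by
  by_cases hl : l = i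
  · subst hl
    unfold pairField slotField
    split_ifs with hf
    · simp
    · rw [Function.update_self, Function.update_of_ne hf]
  · obtain rfl : l = f.1 i := h.resolve_left hl
    rw [pairField, slotField, if_neg hl, f.2 i, if_neg (Ne.symm hl), Function.update_self,
      Function.update_of_ne (Ne.symm hl), ζ_comm]

theorem pairField_update_of_notMem (c : ℝ) {n : ℕ} (B : Fin n → FieldPoly) (f : Invol n)
    {i l : Fin n} (h : ¬(l = i ∨ l = f.1 i)) (P : FieldPoly) :
    pairField c (Function.update B l P) f i = pairField c B f i := by
  rw [not_or] at h
  rw [pairField, pairField, Function.update_of_ne (Ne.symm h.1), Function.update_of_ne (Ne.symm h.2)]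

/-- Only the block containing `l` sees the change, and it depends linearly on the new entry;
multilinearity of `hatT` thus reduces to that of `T` in one slot. -/
theorem blockField_update (c : ℝ) {n : ℕ} (B : Fin n → FieldPoly) (f : Invol n) (l : Fin n)
    (P : FieldPoly) :
    blockField c (Function.update B l P) f.partition =
      Function.update (blockField c B f.partition) (blockIndex f.partition l)
        (slotField c B f l P) := by
  funext a
  obtain ⟨i, rfl⟩ := blockIndex_surjective f.partition a
  have h := (isBlockMap_blockIndex f).eq_iff i l
  rw [blockField_blockIndex]
  by_cases hi : l = i ∨ l = f.1 i
  · rw [pairField_update_of_mem c B f hi, h.2 hi, Function.update_self]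
  · rw [pairField_update_of_notMem c B f hi, Function.update_of_ne (mt h.1 hi),
      blockField_blockIndex]

theorem insertZ_update (c : ℝ) (T : ProductFamily) {n : ℕ} (B : Fin n → FieldPoly) (f : Invol n)
    (l : Fin n) (P : FieldPoly) :
    insertZ c T (Function.update B l P) f.partition =
      onDiagonal (blockIndex f.partition) (blockIndex_surjective _)
        (T _ (Function.update (blockField c B f.partition) (blockIndex f.partition l)
          (slotField c B f l P))) := by
  rw [insertZ, blockField_update]

theorem ProductFamily.IsPreTimeOrdered.map_zero {T : ProductFamily} (hT : T.IsPreTimeOrdered)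
    {n : ℕ} (B : Fin n → FieldPoly) (l : Fin n) : T n (Function.update B l 0) = 0 := by
  have := hT.map_smul n B l 0 0
  rwa [C_0, zero_mul, cmul_zero_left] at this

theorem hatT_map_add (c : ℝ) {T : ProductFamily} (hT : T.IsPreTimeOrdered) (n : ℕ)
    (B : Fin n → FieldPoly) (l : Fin n) (P Q : FieldPoly) :
    hatT c T n (Function.update B l (P + Q)) =
      hatT c T n (Function.update B l P) + hatT c T n (Function.update B l Q) := by
  simp only [hatT_eq_sum_invol, insertZ_update, slotField_add, hT.map_add, onDiagonal_add,
    cmul_add, Finset.sum_add_distrib]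

theorem hatT_map_smul (c : ℝ) {T : ProductFamily} (hT : T.IsPreTimeOrdered) (n : ℕ)
    (B : Fin n → FieldPoly) (l : Fin n) (z : ℂ) (P : FieldPoly) :
    hatT c T n (Function.update B l (C z * P)) = cmul z (hatT c T n (Function.update B l P)) := by
  simp only [hatT_eq_sum_invol, insertZ_update, slotField_C_mul, hT.map_smul, onDiagonal_cmul,
    cmul_sum, cmul_cmul]
  refine Finset.sum_congr rfl fun f _ => ?_
  congr 1
  ring

/-- The trivial involution. -/
def Invol.one (n : ℕ) : Invol n := ⟨id, fun _ => rfl⟩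

theorem isBlockMap_one (n : ℕ) : IsBlockMap (Invol.one n) (id : Fin n → Fin n) where
  surjective := Function.surjective_id
  eq_iff i i' := by simp [Invol.one, eq_comm]

theorem insertZ_one {T : ProductFamily} (hT : T.IsPreTimeOrdered) (c : ℝ) {n : ℕ}
    (B : Fin n → FieldPoly) : insertZ c T B (Invol.one n).partition = T n B := by
  rw [(isBlockMap_one n).insertZ_eq hT (F := B) fun i => by simp [pairField, Invol.one]]
  rfl

theorem hatT_initial (c : ℝ) {T : ProductFamily} (hT : T.IsPreTimeOrdered)
    (B : Fin 1 → FieldPoly) : hatT c T 1 B = T 1 B := by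
  rw [hatT_eq_sum_invol, Fintype.sum_eq_single (Invol.one 1), (isBlockMap_one 1).card_parts,
    insertZ_one hT, cmul_cmul, inv_mul_cancel₀ (by simp), cmul_one_left]
  intro f hf
  exact absurd (Subsingleton.elim _ _) hf

/-- Conjugation of an involution by a permutation. -/
def Invol.conj {n : ℕ} (π : Equiv.Perm (Fin n)) : Invol n ≃ Invol n where
  toFun f := ⟨fun i => π (f.1 (π.symm i)), fun i => by simp [f.2 _]⟩
  invFun f := ⟨fun i => π.symm (f.1 (π i)), fun i => by simp [f.2 _]⟩
  left_inv f := by simp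
  right_inv f := by simp

theorem isBlockMap_conj {n k : ℕ} {f : Invol n} {σ : Fin n → Fin k} (h : IsBlockMap f σ)
    (π : Equiv.Perm (Fin n)) : IsBlockMap (Invol.conj π f) (σ ∘ π.symm) where
  surjective := h.surjective.comp π.symm.surjective
  eq_iff i i' := by simp [h.eq_iff, Invol.conj, Equiv.symm_apply_eq]

theorem hatT_symm (c : ℝ) {T : ProductFamily} (hT : T.IsPreTimeOrdered) (n : ℕ)
    (π : Equiv.Perm (Fin n)) (B : Fin n → FieldPoly) :
    onDiagonal π.symm π.symm.surjective (hatT c T n fun i => B (π i)) = hatT c T n B := by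
  rw [hatT_eq_sum_invol, hatT_eq_sum_invol, onDiagonal_cmul, onDiagonal_sum]
  congr 1
  refine Fintype.sum_equiv (Invol.conj π) _ _ fun f => ?_
  have h := isBlockMap_conj (isBlockMap_blockIndex f) π
  rw [onDiagonal_cmul, h.card_parts, 
    -- The block fields of the permuted arguments serve unchanged for the conjugated partition, with
    -- its blocks numbered through `π.symm`.
    h.insertZ_eq hT (F := blockField c (fun i => B (π i)) f.partition)]
  · rfl
  · intro i
    simp only [Function.comp_apply, blockField_blockIndex, pairField, Invol.conj,
      Equiv.coe_fn_mk, Equiv.apply_symm_apply, Equiv.eq_symm_apply]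
    by_cases hi : π (f.1 (π.symm i)) = i <;> simp [hi]

theorem isPreTimeOrdered_hatT (c : ℝ) {T : ProductFamily} (hT : T.IsPreTimeOrdered) :
    (hatT c T).IsPreTimeOrdered where
  map_add := hatT_map_add c hT
  map_smul := hatT_map_smul c hT
  initial B := by
    rw [hatT_initial c hT]
    exact hT.initial B
  symm := hatT_symm c hT

theorem hatT_zero {T : ProductFamily} (hT : T.IsPreTimeOrdered) : hatT 0 T = T := by
  funext n B
  rw [hatT_eq_sum_invol, Fintype.sum_eq_single (Invol.one n), (isBlockMap_one n).card_parts,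
    insertZ_one hT, cmul_cmul, inv_mul_cancel₀ (by simp), cmul_one_left]
  intro f hf
  obtain ⟨i, hi⟩ : ∃ i, f.1 i ≠ i := by
    by_contra! h
    exact hf (Subtype.ext (funext h))
  -- Rewriting `B` as a trivial update at a non-fixed point exposes the block field of a pair, which
  -- carries the factor `c = 0`.
  rw [← Function.update_eq_self i B, insertZ_update, slotField, if_neg hi, Complex.ofReal_zero,
    C_0, zero_mul, hT.map_zero]
  exact cmul_zero _

/-! ### Involutions of `{1,…,n+1}` -/

/-- Extension of an involution of `{1,…,n}` to `{1,…,n+1}`: the last point is fixed, or it is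
paired with a fixed point. -/
def Invol.adjoin {n : ℕ} (f : Invol n) : Option {l : Fin n // f.1 l = l} → Invol (n + 1)
  | none => ⟨extendLast f.1, fun i => by
      induction i using Fin.lastCases <;> simp [f.2 _]⟩
  | some l => ⟨Fin.snoc (α := fun _ => Fin (n + 1))
      (fun i => if i = l then Fin.last n else (f.1 i).castSucc) l.1.castSucc, fun i => by
      induction i using Fin.lastCases with
      | last => simp
      | cast i =>
        by_cases hi : i = l
        · simp [hi]
        · have : f.1 i ≠ l := fun h => hi (by rw [← f.2 i, h, l.2])
          simp [hi, this, f.2 i]⟩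

@[simp] theorem Invol.adjoin_none_last {n : ℕ} (f : Invol n) :
    (f.adjoin none).1 (Fin.last n) = Fin.last n := by simp [Invol.adjoin]

@[simp] theorem Invol.adjoin_none_castSucc {n : ℕ} (f : Invol n) (i : Fin n) :
    (f.adjoin none).1 i.castSucc = (f.1 i).castSucc := by simp [Invol.adjoin]

@[simp] theorem Invol.adjoin_some_last {n : ℕ} (f : Invol n) (l : {l : Fin n // f.1 l = l}) :
    (f.adjoin (some l)).1 (Fin.last n) = l.1.castSucc := by simp [Invol.adjoin]

@[simp] theorem Invol.adjoin_some_castSucc {n : ℕ} (f : Invol n) (l : {l : Fin n // f.1 l = l})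
    (i : Fin n) : (f.adjoin (some l)).1 i.castSucc =
      if i = l then Fin.last n else (f.1 i).castSucc := by simp [Invol.adjoin]

/-- Recovers `f` from any extension: delete the last point and let its partner, if any, become
fixed. The same recipe gives surjectivity in `adjoin_bijective`. -/
theorem Invol.adjoin_castSucc {n : ℕ} (f : Invol n) (o : Option {l : Fin n // f.1 l = l})
    (i : Fin n) : (f.1 i).castSucc = if (f.adjoin o).1 i.castSucc = Fin.last n then i.castSucc
      else (f.adjoin o).1 i.castSucc := by
  rcases o with _ | l
  · simp
  · by_cases hi : i = l
    · simp [hi, l.2]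
    · simp [hi]

theorem Invol.adjoin_bijective (n : ℕ) : Function.Bijective
    fun p : Σ f : Invol n, Option {l : Fin n // f.1 l = l} => p.1.adjoin p.2 := by
  constructor
  · rintro ⟨f, o⟩ ⟨f', o'⟩ h
    dsimp only at h
    obtain rfl : f = f' := Subtype.ext <| funext fun i => Fin.castSucc_injective _ <| by
      rw [f.adjoin_castSucc o, f'.adjoin_castSucc o', h]
    have hl := congrArg (fun g : Invol (n + 1) => g.1 (Fin.last n)) h
    rcases o with _ | l <;> rcases o' with _ | l'
    · rfl
    · simp only [adjoin_none_last, adjoin_some_last] at hl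
      exact absurd hl.symm (Fin.castSucc_ne_last _)
    · simp only [adjoin_none_last, adjoin_some_last] at hl
      exact absurd hl (Fin.castSucc_ne_last _)
    · simp only [adjoin_some_last] at hl
      rw [Subtype.ext (Fin.castSucc_injective _ hl)]
  · intro g
    have hex (i : Fin n) : ∃ k : Fin n, k.castSucc =
        if g.1 i.castSucc = Fin.last n then i.castSucc else g.1 i.castSucc := by
      split_ifs with h
      · exact ⟨i, rfl⟩
      · exact ⟨(g.1 i.castSucc).castPred h, Fin.castSucc_castPred _ h⟩
    choose f hf using hex
    have hinv : Function.Involutive f := fun i => by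
      apply Fin.castSucc_injective
      by_cases h : g.1 i.castSucc = Fin.last n
      · have : f i = i := Fin.castSucc_injective _ (by rw [hf, if_pos h])
        rw [this, this]
      · rw [hf, hf i, if_neg h, g.2 _, if_neg (Fin.castSucc_ne_last i)]
    -- The partner of the last point decides which kind of extension `g` is.
    rcases Fin.eq_castSucc_or_eq_last (g.1 (Fin.last n)) with ⟨l, hl⟩ | hlast
    · have hl' : g.1 l.castSucc = Fin.last n := by rw [← hl, g.2]
      have hfl : f l = l := Fin.castSucc_injective _ (by rw [hf, if_pos hl'])
      refine ⟨⟨⟨f, hinv⟩, some ⟨l, hfl⟩⟩, Subtype.ext (funext fun i => ?_)⟩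
      induction i using Fin.lastCases with
      | last => simp [hl]
      | cast i =>
        by_cases hi : i = l
        · simp [hi, hl']
        · have : g.1 i.castSucc ≠ Fin.last n := fun h => hi <| Fin.castSucc_injective _ <|
            g.2.injective (h.trans hl'.symm)
          simp [hi, hf, this]
    · refine ⟨⟨⟨f, hinv⟩, none⟩, Subtype.ext (funext fun i => ?_)⟩
      induction i using Fin.lastCases with
      | last => simp [hlast]
      | cast i =>
        have : g.1 i.castSucc ≠ Fin.last n := fun h => Fin.castSucc_ne_last i <|
          g.2.injective (h.trans hlast.symm)
        simp [hf, this]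

theorem sum_invol_succ {n : ℕ} {M : Type*} [AddCommMonoid M] (G : Invol (n + 1) → M) :
    ∑ g, G g = ∑ f : Invol n, (G (f.adjoin none) + ∑ l, G (f.adjoin (some l))) := by
  rw [← (Invol.adjoin_bijective n).sum_comp, Fintype.sum_sigma]
  exact Finset.sum_congr rfl fun f _ => Fintype.sum_option _

theorem isBlockMap_adjoin_none {n k : ℕ} {f : Invol n} {σ : Fin n → Fin k} (h : IsBlockMap f σ) :
    IsBlockMap (f.adjoin none) (extendLast σ) where
  surjective := surjective_extendLast h.surjective
  eq_iff i i' := by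
    induction i using Fin.lastCases <;> induction i' using Fin.lastCases <;>
      simp [h.eq_iff, Fin.castSucc_ne_last, (Fin.castSucc_ne_last _).symm]

theorem isBlockMap_adjoin_some {n k : ℕ} {f : Invol n} {σ : Fin n → Fin k} (h : IsBlockMap f σ)
    (l : {l : Fin n // f.1 l = l}) :
    IsBlockMap (f.adjoin (some l)) (Fin.snoc (α := fun _ => Fin k) σ (σ l)) where
  surjective := surjective_snoc h.surjective _
  eq_iff i i' := by
    obtain ⟨l, hl⟩ := l
    have hl' (i : Fin n) (hi : l = f.1 i) : i = l := by rw [← f.2 i, ← hi, hl]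
    induction i using Fin.lastCases with
    | last =>
      induction i' using Fin.lastCases with
      | last => simp
      | cast i' => simp [h.eq_iff, hl, Fin.castSucc_ne_last]
    | cast i =>
      induction i' using Fin.lastCases with
      | last =>
        by_cases hi : i = l
        · simp [hi]
        · have := mt (hl' i) hi
          simp [h.eq_iff, hi, Ne.symm hi, this, (Fin.castSucc_ne_last _).symm]
      | cast i' =>
        by_cases hi : i = l
        · simp [h.eq_iff, hi, hl, Fin.castSucc_ne_last]
        · simp [h.eq_iff, hi]

/-! ### The Ward identities for the renormalized product -/

theorem deltaAt_sum {n : ℕ} (l : Fin n) {ι : Type*} (t : Finset ι) (S : ι → FieldDistribution n) :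
    deltaAt l (∑ i ∈ t, S i) = ∑ i ∈ t, deltaAt l (S i) :=
  onDiagonal_sum _ _ _

theorem deltaAt_cmul {n : ℕ} (l : Fin n) (z : ℂ) (S : FieldDistribution n) :
    deltaAt l (cmul z S) = cmul z (deltaAt l S) := rfl

/-- `S(x_1,…,x_k,y)` on the partial diagonal of the `x_i` given by the orbits of `f`. -/
def onOrbits {n : ℕ} (f : Invol n) (S : FieldDistribution (f.partition.parts.card + 1)) :
    FieldDistribution (n + 1) :=
  onDiagonal (extendLast (blockIndex f.partition))
    (surjective_extendLast (blockIndex_surjective _)) S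

theorem onOrbits_sum {n : ℕ} (f : Invol n) {ι : Type*} (t : Finset ι)
    (S : ι → FieldDistribution (f.partition.parts.card + 1)) :
    onOrbits f (∑ i ∈ t, S i) = ∑ i ∈ t, onOrbits f (S i) :=
  onDiagonal_sum _ _ _

theorem onOrbits_add {n : ℕ} (f : Invol n)
    (S S' : FieldDistribution (f.partition.parts.card + 1)) :
    onOrbits f (S + S') = onOrbits f S + onOrbits f S' := rfl

theorem onOrbits_cmul {n : ℕ} (f : Invol n) (z : ℂ)
    (S : FieldDistribution (f.partition.parts.card + 1)) :
    onOrbits f (cmul z S) = cmul z (onOrbits f S) := rfl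

theorem dy_onOrbits {n : ℕ} (f : Invol n) (μ : Fin 4)
    (S : FieldDistribution (f.partition.parts.card + 1)) :
    dy μ (onOrbits f S) = onOrbits f (dy μ S) :=
  dy_onDiagonal (blockIndex_surjective _) μ S

theorem onOrbits_deltaAt {n : ℕ} (f : Invol n) (a : Fin f.partition.parts.card)
    (S : FieldDistribution f.partition.parts.card) :
    onOrbits f (deltaAt a S) =
      onDiagonal (Fin.snoc (α := fun _ => Fin f.partition.parts.card) (blockIndex f.partition) a)
        (surjective_snoc (blockIndex_surjective _) a) S :=
  onDiagonal_deltaAt (blockIndex_surjective _) a S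

/-- `i^{-n} ∑_P i^{|P|} S_P`, where `S_P` is a distribution in the blocks of `P` and in `y`. -/
def blockSum {n : ℕ} (S : (f : Invol n) → FieldDistribution (f.partition.parts.card + 1)) :
    FieldDistribution (n + 1) :=
  cmul (Complex.I ^ n)⁻¹ (∑ f, cmul (Complex.I ^ f.partition.parts.card) (onOrbits f (S f)))

theorem blockSum_apply {n : ℕ}
    (S : (f : Invol n) → FieldDistribution (f.partition.parts.card + 1)) (g : TestFun (n + 1))
    (s : Config) :
    blockSum S g s = (Complex.I ^ n)⁻¹ *
      ∑ f, Complex.I ^ f.partition.parts.card * onOrbits f (S f) g s := by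
  have h (S : Invol n → FieldDistribution (n + 1)) : (∑ f, S f) g s = ∑ f, S f g s := by
    rw [← Finset.sum_apply, sum_apply]
  simp only [blockSum, cmul_apply, h]

/-- Both points of a pair sit at the same place, so their two `δ` terms merge, and the Leibniz rule
`hD` identifies the sum with `D` acting on the block field. `hD` is required only on pairs, hence is
vacuous for the trivial involution. -/
theorem sum_deltaAt_insertZ {T : ProductFamily} (hT : T.IsPreTimeOrdered) (c : ℝ) {n : ℕ}
    (B : Fin n → FieldPoly) (f : Invol n) (D : FieldPoly → FieldPoly)
    (hD : ∀ l, f.1 l ≠ l → D (C (c : ℂ) * ζ (B l) (B (f.1 l))) =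
      C (c : ℂ) * ζ (D (B l)) (B (f.1 l)) + C (c : ℂ) * ζ (B l) (D (B (f.1 l)))) :
    ∑ l, deltaAt l (insertZ c T (Function.update B l (D (B l))) f.partition) =
      onOrbits f (∑ a, deltaAt a (T _ (Function.update (blockField c B f.partition) a
        (D (blockField c B f.partition a))))) := by
  have hσ := isBlockMap_blockIndex f
  simp only [onOrbits_sum, insertZ_update, deltaAt_onDiagonal, onOrbits_deltaAt]
  -- Group the points by their block; each fibre is an orbit `{i, f i}`.
  rw [← Finset.sum_fiberwise Finset.univ (blockIndex f.partition)]
  refine Finset.sum_congr rfl fun a _ => ?_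
  obtain ⟨i, rfl⟩ := hσ.surjective a
  have hfib : ({l | blockIndex f.partition l = blockIndex f.partition i} : Finset (Fin n)) =
      {i, f.1 i} := by
    ext l
    simp only [Finset.mem_filter, Finset.mem_univ, true_and, Finset.mem_insert,
      Finset.mem_singleton]
    rw [eq_comm, hσ.eq_iff]
  rw [hfib, blockField_blockIndex]
  by_cases hi : f.1 i = i
  · rw [hi, Finset.pair_eq_singleton, Finset.sum_singleton, slotField, if_pos hi, pairField,
      if_pos hi]
  · have hσi : blockIndex f.partition (f.1 i) = blockIndex f.partition i :=
      ((hσ.eq_iff _ _).2 (.inr rfl)).symm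
    rw [Finset.sum_pair (Ne.symm hi)]
    simp only [hσi]
    rw [pairField, if_neg hi, hD i hi, hT.map_add,
      onDiagonal_add, slotField, slotField, f.2 i, if_neg hi, if_neg (Ne.symm hi),
      ζ_comm (D (B (f.1 i)))]

theorem sum_deltaAt_hatT {T : ProductFamily} (hT : T.IsPreTimeOrdered) (c : ℝ) {n : ℕ}
    (B : Fin n → FieldPoly) (D : FieldPoly → FieldPoly)
    (hD : ∀ l l', D (C (c : ℂ) * ζ (B l) (B l')) =
      C (c : ℂ) * ζ (D (B l)) (B l') + C (c : ℂ) * ζ (B l) (D (B l'))) :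
    ∑ l, deltaAt l (hatT c T n (Function.update B l (D (B l)))) =
      blockSum fun f => ∑ a, deltaAt a (T _ (Function.update (blockField c B f.partition) a
        (D (blockField c B f.partition a)))) := by
  simp only [hatT_eq_sum_invol, deltaAt_cmul, deltaAt_sum, blockSum, ← cmul_sum]
  rw [Finset.sum_comm]
  simp only [← cmul_sum]
  congr 1
  refine Finset.sum_congr rfl fun f _ => ?_
  congr 1
  exact sum_deltaAt_insertZ hT c B f D fun l _ => hD _ _

theorem thetaTerm_hatT {T : ProductFamily} (hT : T.IsPreTimeOrdered) (c : ℝ) {n : ℕ}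
    (B : Fin n → FieldPoly) :
    thetaTerm (hatT c T) n B =
      blockSum fun f => thetaTerm T _ (blockField c B f.partition) :=
  sum_deltaAt_hatT hT c B θ fun l l' => by rw [θ_C_mul, θ_ζ, mul_add]

theorem dy_blockSum {n : ℕ} (μ : Fin 4)
    (S : (f : Invol n) → FieldDistribution (f.partition.parts.card + 1)) :
    dy μ (blockSum S) = blockSum fun f => dy μ (S f) := by
  simp only [blockSum, dy_cmul, dy_sum, dy_onOrbits]

theorem blockSum_sum {n : ℕ} {ι : Type*} (t : Finset ι)
    (S : ι → (f : Invol n) → FieldDistribution (f.partition.parts.card + 1)) :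
    blockSum (fun f => ∑ i ∈ t, S i f) = ∑ i ∈ t, blockSum (S i) := by
  simp only [blockSum, onOrbits_sum, cmul_sum]
  rw [Finset.sum_comm]

theorem blockSum_cmul {n : ℕ} (z : ℂ)
    (S : (f : Invol n) → FieldDistribution (f.partition.parts.card + 1)) :
    blockSum (fun f => cmul z (S f)) = cmul z (blockSum S) := by
  simp only [blockSum, onOrbits_cmul, cmul_sum, cmul_cmul]
  refine Finset.sum_congr rfl fun f _ => ?_
  congr 1
  ring

theorem thetaLowTerm_hatT {T : ProductFamily} (hT : T.IsPreTimeOrdered) (c : ℝ) {n : ℕ}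
    {B : Fin n → FieldPoly} (hB : ∀ l, AtMostOneDerivative (B l)) :
    thetaLowTerm (hatT c T) n B =
      blockSum fun f => thetaLowTerm T _ (blockField c B f.partition) := by
  simp only [thetaLowTerm]
  rw [blockSum_sum]
  refine Finset.sum_congr rfl fun μ _ => ?_
  rw [sum_deltaAt_hatT hT c B (θlow μ), dy_blockSum, ← cmul_ofReal, ← blockSum_cmul]
  · simp only [cmul_ofReal]
  -- The Leibniz rule for `θ_μ` holds because all three terms vanish.
  · intro l l'
    rw [(((hB l).noDerivative_ζ (hB l')).C_mul _).θlow, ((hB l).noDerivative_θlow μ).ζ_left,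
      ζ_comm, ((hB l').noDerivative_θlow μ).ζ_left]
    simp

theorem sum_insertZ_adjoin_some {T : ProductFamily} (hT : T.IsPreTimeOrdered) (c : ℝ) {n : ℕ}
    {B : Fin n → FieldPoly} (hB : ∀ l, AtMostOneDerivative (B l)) (μ : Fin 4) (f : Invol n) :
    ∑ l : {l : Fin n // f.1 l = l}, insertZ c T (Fin.snoc (α := fun _ => FieldPoly) B (j μ))
        (f.adjoin (some l)).partition =
      cmul (c * (Complex.I * (η μ : ℂ))) (∑ l, deltaAt l
        (insertZ c T (Function.update B l (θlow μ (B l))) f.partition)) := by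
  classical
  have hσ := isBlockMap_blockIndex f
  obtain ⟨z, hz⟩ : ∃ z : ℂ, z = c * (Complex.I * (η μ : ℂ)) := ⟨_, rfl⟩
  -- The sum over fixed points is extended to all `l`; the added terms are shown to vanish in the
  -- last bullet.
  rw [← hz, ← Finset.sum_subset (Finset.filter_subset (fun l => f.1 l = l) Finset.univ),
    Finset.sum_subtype (p := fun l => f.1 l = l) _ (fun l => by simp), cmul_sum]
  · refine Finset.sum_congr rfl fun l _ => ?_
    rw [(isBlockMap_adjoin_some hσ l).insertZ_eq hT (F := Function.update
        (blockField c B f.partition) (blockIndex f.partition l)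
          (C z * θlow μ (B l))),
      hT.map_smul, onDiagonal_cmul, insertZ_update, deltaAt_onDiagonal, slotField, if_pos l.2]
    intro i
    have hζ : C z * θlow μ (B l) = C (c : ℂ) * ζ (B l) (j μ) := by
      rw [ζ_j, hz, C_mul, mul_assoc]
    induction i using Fin.lastCases with
    | last => simp [pairField, hζ, (Fin.castSucc_ne_last _), ζ_comm (j μ)]
    | cast i =>
      by_cases hi : i = l
      · simp [hi, pairField, hζ, (Fin.castSucc_ne_last _).symm]
      · have : ¬ blockIndex f.partition i = blockIndex f.partition l := by
          rw [eq_comm, hσ.eq_iff, l.2, or_self]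
          exact hi
        simp [this, hi, pairField, blockField_blockIndex]
  -- A paired `l` contributes `c ζ(θ_μ B_l, ·)`, which is zero since `θ_μ B_l` has no derivated
  -- field.
  · intro l _ hl
    have hl : f.1 l ≠ l := by simpa using hl
    rw [insertZ_update, slotField, if_neg hl, ((hB l).noDerivative_θlow μ).ζ_left, mul_zero,
      hT.map_zero]
    rfl

theorem insertZ_adjoin_none {T : ProductFamily} (hT : T.IsPreTimeOrdered) (c : ℝ) {n : ℕ}
    (B : Fin n → FieldPoly) (P : FieldPoly) (f : Invol n) :
    insertZ c T (Fin.snoc (α := fun _ => FieldPoly) B P) (f.adjoin none).partition =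
      onOrbits f (T _ (Fin.snoc (α := fun _ => FieldPoly) (blockField c B f.partition) P)) := by
  refine (isBlockMap_adjoin_none (isBlockMap_blockIndex f)).insertZ_eq hT fun i => ?_
  induction i using Fin.lastCases <;> simp [pairField, blockField_blockIndex]

/-- With `y` alone the powers are `i^{-(n+1)} i^{|P|+1}`; with `y` paired they are `i^{-(n+1)}
i^{|P|}` times the `i` of `ζ_j`. Both equal the weight `i^{-n} i^{|P|}` of `P` in order `n`. -/
theorem hatT_snoc_j {T : ProductFamily} (hT : T.IsPreTimeOrdered) (c : ℝ) {n : ℕ}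
    {B : Fin n → FieldPoly} (hB : ∀ l, AtMostOneDerivative (B l)) (μ : Fin 4) :
    hatT c T (n + 1) (Fin.snoc (α := fun _ => FieldPoly) B (j μ)) =
      (blockSum fun f => T _ (Fin.snoc (α := fun _ => FieldPoly) (blockField c B f.partition)
        (j μ))) +
      cmul (c * (η μ : ℂ)) (∑ l, deltaAt l (hatT c T n (Function.update B l (θlow μ (B l))))) := by
  have hnone (f : Invol n) : (f.adjoin none).partition.parts.card = f.partition.parts.card + 1 :=
    (isBlockMap_adjoin_none (isBlockMap_blockIndex f)).card_parts
  have hsome (f : Invol n) (l) : (f.adjoin (some l)).partition.parts.card =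
      f.partition.parts.card := (isBlockMap_adjoin_some (isBlockMap_blockIndex f) l).card_parts
  simp only [hatT_eq_sum_invol c T (n + 1), sum_invol_succ, hnone, hsome, ← cmul_sum,
    sum_insertZ_adjoin_some hT c hB, insertZ_adjoin_none hT, Finset.sum_add_distrib, cmul_add]
  congr 1
  · rw [blockSum, cmul_sum, cmul_sum]
    refine Finset.sum_congr rfl fun f _ => ?_
    rw [cmul_cmul, cmul_cmul]
    congr 1
    field_simp
    ring
  · simp only [hatT_eq_sum_invol, deltaAt_cmul, deltaAt_sum, ← cmul_sum, cmul_cmul]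
    rw [Finset.sum_comm (γ := Fin n)]
    simp only [cmul_sum, cmul_cmul]
    refine Finset.sum_congr rfl fun f _ => Finset.sum_congr rfl fun l _ => ?_
    congr 1
    field_simp
    ring

theorem divCurrent_hatT {T : ProductFamily} (hT : T.IsPreTimeOrdered) (c : ℝ) {n : ℕ}
    {B : Fin n → FieldPoly} (hB : ∀ l, AtMostOneDerivative (B l)) :
    divCurrent (hatT c T) n B =
      (blockSum fun f => divCurrent T _ (blockField c B f.partition)) +
        c • thetaLowTerm (hatT c T) n B := by
  simp only [divCurrent, hatT_snoc_j hT c hB, dy_add, Finset.sum_add_distrib, blockSum_sum,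
    dy_blockSum, dy_cmul]
  rw [thetaLowTerm, ← cmul_ofReal, cmul_sum]
  simp only [← cmul_ofReal, cmul_cmul]

/-- The violation of the on-shell Master Ward Identity. -/
def anomaly (T : ProductFamily) (n : ℕ) (B : Fin n → FieldPoly) : FieldDistribution (n + 1) :=
  divCurrent T n B - (thetaTerm T n B - thetaLowTerm T n B)

theorem MWI_iff_anomaly (m : ℝ) (T : ProductFamily) (n : ℕ) (B : Fin n → FieldPoly) :
    MWI m T n B ↔ ∀ (g : TestFun (n + 1)) (s : Config), s.IsOnShell m → anomaly T n B g s = 0 := by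
  simp only [MWI, EqOnShell, anomaly]
  exact forall₃_congr fun g s _ => sub_eq_zero.symm

theorem WI_iff_blockSum_anomaly (m c : ℝ) {T : ProductFamily} (hT : T.IsPreTimeOrdered) {n : ℕ}
    {B : Fin n → FieldPoly} (hB : ∀ l, AtMostOneDerivative (B l)) :
    WI m c (hatT c T) n B ↔ ∀ (g : TestFun (n + 1)) (s : Config), s.IsOnShell m →
      blockSum (fun f => anomaly T _ (blockField c B f.partition)) g s = 0 := by
  have h : (blockSum fun f => anomaly T _ (blockField c B f.partition)) =
      divCurrent (hatT c T) n B -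
        (thetaTerm (hatT c T) n B + (c - 1) • thetaLowTerm (hatT c T) n B) := by
    have hsub (S S' : (f : Invol n) → FieldDistribution (f.partition.parts.card + 1)) :
        (blockSum fun f => S f - S' f) = blockSum S - blockSum S' := by
      rw [eq_sub_iff_add_eq]
      simp only [blockSum, ← cmul_add, ← Finset.sum_add_distrib, ← onOrbits_add,
        sub_add_cancel]
    simp only [anomaly, hsub, divCurrent_hatT hT c hB, ← thetaTerm_hatT hT,
      ← thetaLowTerm_hatT hT c hB]
    -- The coefficients of the `θ_μ` term combine as `c - (c - 1) = 1`.
    module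
  rw [h]
  exact forall₃_congr fun g s _ => sub_eq_zero.symm

theorem admissible_blockField (c : ℝ) {n : ℕ} {B : Fin n → FieldPoly}
    (hB : ∀ l, Admissible (B l)) (f : Invol n) (a : Fin f.partition.parts.card) :
    Admissible (blockField c B f.partition a) := by
  obtain ⟨i, rfl⟩ := blockIndex_surjective f.partition a
  rw [blockField_blockIndex, pairField]
  split_ifs
  · exact hB i
  · exact (hB i).C_mul_ζ (hB _) _

theorem Invol.card_parts_le {n : ℕ} (f : Invol n) : f.partition.parts.card ≤ n := by
  simpa using Fintype.card_le_of_surjective _ (blockIndex_surjective f.partition)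

theorem Invol.card_parts_pos {n : ℕ} (f : Invol n) (hn : 1 ≤ n) :
    1 ≤ f.partition.parts.card :=
  Fin.pos (blockIndex f.partition ⟨0, hn⟩)

/-- With as many blocks as points the numbering is injective, so `i` and `f i`, lying in one block,
coincide. -/
theorem Invol.eq_one_of_card_parts {n : ℕ} {f : Invol n} (h : f.partition.parts.card = n) :
    f = Invol.one n := by
  have hinj : Function.Injective (blockIndex f.partition) :=
    ((Fintype.bijective_iff_surjective_and_card _).2
      ⟨blockIndex_surjective f.partition, by simp [h]⟩).1
  refine Subtype.ext (_root_.funext fun i => ?_)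
  exact (hinj (((isBlockMap_blockIndex f).eq_iff i _).2 (.inr rfl))).symm

theorem Invol.one_adjoin_none (n : ℕ) : (Invol.one n).adjoin none = Invol.one (n + 1) := by
  refine Subtype.ext (_root_.funext fun i => ?_)
  induction i using Fin.lastCases <;> simp [Invol.one]

/-- Not definitional, because the singletons are numbered arbitrarily; each term is brought back
through `insertZ_one`, which uses the symmetry of `T`. -/
theorem onOrbits_one_anomaly {T : ProductFamily} (hT : T.IsPreTimeOrdered) (c : ℝ) {n : ℕ}
    (B : Fin n → FieldPoly) :
    onOrbits (Invol.one n) (anomaly T _ (blockField c B (Invol.one n).partition)) =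
      anomaly T n B := by
  have hj (P : FieldPoly) : onOrbits (Invol.one n) (T _ (Fin.snoc (α := fun _ => FieldPoly)
      (blockField c B (Invol.one n).partition) P)) =
        T (n + 1) (Fin.snoc (α := fun _ => FieldPoly) B P) := by
    rw [← insertZ_adjoin_none hT, Invol.one_adjoin_none, insertZ_one hT]
  have hD (D : FieldPoly → FieldPoly) : onOrbits (Invol.one n) (∑ a, deltaAt a (T _
      (Function.update (blockField c B (Invol.one n).partition) a
        (D (blockField c B (Invol.one n).partition a))))) =
          ∑ l, deltaAt l (T n (Function.update B l (D (B l)))) := by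
    rw [← sum_deltaAt_insertZ hT c B (Invol.one n) D fun l hl => absurd rfl hl]
    simp only [insertZ_one hT]
  have hsub (S S' : FieldDistribution ((Invol.one n).partition.parts.card + 1)) :
      onOrbits (Invol.one n) (S - S') = onOrbits (Invol.one n) S - onOrbits (Invol.one n) S' := rfl
  rw [anomaly, anomaly, hsub, hsub]
  congr 1
  · simp only [divCurrent, ← hj, onOrbits_sum, dy_onOrbits]
  · congr 1
    · exact hD θ
    · simp only [thetaLowTerm, ← hD, ← cmul_ofReal, onOrbits_sum, onOrbits_cmul, dy_onOrbits,
        dy_sum]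

/-- Up to the contributions of partitions with fewer than `n` blocks, the violation of the
`c`-dependent Ward identity is the violation of the Master Ward Identity. -/
theorem blockSum_anomaly_eq (m c : ℝ) {T : ProductFamily} (hT : T.IsPreTimeOrdered) {n : ℕ}
    (hn : 1 ≤ n) {B : Fin n → FieldPoly} (hB : ∀ l, Admissible (B l))
    (h : ∀ k, 1 ≤ k → k < n → ∀ F : Fin k → FieldPoly, (∀ a, Admissible (F a)) → MWI m T k F)
    (g : TestFun (n + 1)) {s : Config} (hs : s.IsOnShell m) :
    blockSum (fun f => anomaly T _ (blockField c B f.partition)) g s = anomaly T n B g s := by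
  -- Every nontrivial involution has fewer than `n` orbits, so its term vanishes on shell by `h`.
  rw [blockSum_apply, Fintype.sum_eq_single (Invol.one n), onOrbits_one_anomaly hT,
    (isBlockMap_one n).card_parts, inv_mul_cancel_left₀ (by simp)]
  intro f hf
  have hlt : f.partition.parts.card < n :=
    lt_of_le_of_ne f.card_parts_le (mt Invol.eq_one_of_card_parts hf)
  rw [onOrbits, onDiagonal_apply, (MWI_iff_anomaly m T _ _).1
    (h _ (f.card_parts_pos hn) hlt _ (admissible_blockField c hB f)) _ s hs, mul_zero]

theorem WI_iff_MWI_of_lower_MWI (m c : ℝ) {T : ProductFamily} (hT : T.IsPreTimeOrdered) {n : ℕ}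
    (hn : 1 ≤ n) {B : Fin n → FieldPoly} (hB : ∀ l, Admissible (B l))
    (h : ∀ k, 1 ≤ k → k < n → ∀ F : Fin k → FieldPoly, (∀ a, Admissible (F a)) → MWI m T k F) :
    WI m c (hatT c T) n B ↔ MWI m T n B := by
  rw [WI_iff_blockSum_anomaly m c hT fun l => (hB l).2, MWI_iff_anomaly]
  exact forall₃_congr fun g s hs => by rw [blockSum_anomaly_eq m c hT hn hB h g hs]

/-- Forwards, the lower-order identities for `T` are given; backwards, they come from strong
induction. -/
theorem MWI_iff_WI_upTo (m c : ℝ) {T : ProductFamily} (hT : T.IsPreTimeOrdered) (N : ℕ) :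
    (∀ n : ℕ, 1 ≤ n → n ≤ N → ∀ B : Fin n → FieldPoly, (∀ l, Admissible (B l)) → MWI m T n B) ↔
      ∀ n : ℕ, 1 ≤ n → n ≤ N → ∀ B : Fin n → FieldPoly, (∀ l, Admissible (B l)) →
        WI m c (hatT c T) n B := by
  constructor
  · intro h n hn hnN B hB
    exact (WI_iff_MWI_of_lower_MWI m c hT hn hB fun k hk hkn => h k hk (hkn.le.trans hnN)).2
      (h n hn hnN B hB)
  · intro h n
    induction n using Nat.strong_induction_on with
    | _ n ih =>
      intro hn hnN B hB
      exact (WI_iff_MWI_of_lower_MWI m c hT hn hB fun k hk hkn =>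
        ih k hkn hk (hkn.le.trans hnN)).1 (h n hn hnN B hB)

theorem WI_one_iff_NaiveWI (m : ℝ) (T : ProductFamily) (n : ℕ) (B : Fin n → FieldPoly) :
    WI m 1 T n B ↔ NaiveWI m T n B := by
  rw [WI, NaiveWI, sub_self, ← cmul_ofReal, Complex.ofReal_zero, cmul_zero_left, add_zero]

theorem WI_zero_iff_MWI (m : ℝ) (T : ProductFamily) (n : ℕ) (B : Fin n → FieldPoly) :
    WI m 0 T n B ↔ MWI m T n B := by
  have h : cmul (-1) (thetaLowTerm T n B) = -thetaLowTerm T n B :=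
    fieldDistribution_ext fun g s => by
      rw [cmul_apply, neg_one_mul]
      rfl
  rw [WI, MWI, zero_sub, ← cmul_ofReal, Complex.ofReal_neg, Complex.ofReal_one, h, sub_eq_add_neg]

end ScalarQED

end

open ScalarQED in
theorem mainTheorem2 (m c : ℝ) (T : ProductFamily) (hT : T.IsPreTimeOrdered) :
    (hatT c T).IsPreTimeOrdered ∧
    -- equivalence up to every finite order
    (∀ N : ℕ,
      (∀ n : ℕ, 1 ≤ n → n ≤ N → ∀ B : Fin n → FieldPoly, (∀ l, Admissible (B l)) →
        MWI m T n B) ↔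
      (∀ n : ℕ, 1 ≤ n → n ≤ N → ∀ B : Fin n → FieldPoly, (∀ l, Admissible (B l)) →
        WI m c (hatT c T) n B)) ∧
    -- equivalence to all orders
    ((∀ n : ℕ, 1 ≤ n → ∀ B : Fin n → FieldPoly, (∀ l, Admissible (B l)) →
        MWI m T n B) ↔
      (∀ n : ℕ, 1 ≤ n → ∀ B : Fin n → FieldPoly, (∀ l, Admissible (B l)) →
        WI m c (hatT c T) n B)) ∧
    -- the case `c = 1`
    (∀ (n : ℕ) (B : Fin n → FieldPoly),
      WI m 1 (hatT 1 T) n B ↔ NaiveWI m (hatT 1 T) n B) ∧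
    -- the case `c = 0`
    hatT 0 T = T ∧
    (∀ (n : ℕ) (B : Fin n → FieldPoly), WI m 0 (hatT 0 T) n B ↔ MWI m T n B) := by
  refine ⟨isPreTimeOrdered_hatT c hT, MWI_iff_WI_upTo m c hT, ⟨fun h n hn => ?_, fun h n hn => ?_⟩,
    WI_one_iff_NaiveWI m _, hatT_zero hT, fun n B => ?_⟩
  -- The identity of order `n` only needs the finite-order equivalence with `N = n`.
  · exact (MWI_iff_WI_upTo m c hT n).1 (fun k hk _ => h k hk) n hn le_rfl
  · exact (MWI_iff_WI_upTo m c hT n).2 (fun k hk _ => h k hk) n hn le_rfl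
  · rw [hatT_zero hT]
    exact WI_zero_iff_MWI m T n B
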